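/- **Setting.** Let $\mathcal M=(\mathcal S,\mathcal A,H,P^\star,r,s_0)$ be a time-homogeneous finite-horizon MDP with $H\ge 1$, fixed initial state $s_0$, known reward $r:\mathcal S\times\mathcal A\to\mathbb R$, and (possibly infinite) model class $\mathcal P$ of transitions with $P^\star\in\mathcal P$. Transitions are given by densities $P(s'\mid s,a)$ with respect to a finite reference measure on $\mathcal S$ of total mass $|\mathcal S|$ (counting measure if $\mathcal S$ is finite, volume in the continuous case). $\Pi$ is the set of deterministic non-stationary policies $\pi=(\pi_0,\dots,\pi_{H-1})$; $V^\pi_{h;P}(s)$ is the expected total reward of $\pi$ under $P$ from step $h$ and state $s$ to the end, and $V^\pi=V^\pi_{0;P^\star}(s_0)$. Assume $V^\pi_{h;P}(s)\in[0,1]$ for all $\pi\in\Pi$, $0\le h\le H$, $P\in\mathcal P$, $s\in\mathcal S$. Let $d^\pi_h$ be the law of $(s_h,a_h)$ and $\mathrm{Var}_\pi$ the variance of the total reward $\sum_{h=0}^{H-1}r(s_h,a_h)$, both for $\pi$ run under $P^\star$ from $s_0$. **Data.** $\mathcal D$ consists of $K\ge1$ trajectories $s^k_0=s_0,a^k_0,s_1^k,\dots,a_{H-1}^k,s_H^k$.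 The action $a^k_h$ may be chosen adversarially (possibly at random) from the whole history, and $s^k_{h+1}\sim P^\star(s_h^k,a_h^k)$ given the history. **Algorithm.** For $\varepsilon>0$ let $N_{[]}(\varepsilon,\mathcal P,\|\cdot\|_\infty)$ be the least number of brackets $[l,u]$ ($l\le u$ functions on $\mathcal S\times\mathcal A\times\mathcal S$ with $\|u-l\|_\infty\le\varepsilon$) such that every density in $\mathcal P$ lies pointwise in one of them. Put $N=N_{[]}((KH|\mathcal S|)^{-1},\mathcal P,\|\cdot\|_\infty)$, assumed finite, let $\delta\in(0,1)$, and assume $N\ge 2\delta$ (automatic if $N\ge2$ or $\delta\le\frac12$). Put $L=\log(N/\delta)$ and $\beta=7L$. With $\ell_{\mathcal D}(P)=\sum_{k,h}\log P(s^k_{h+1}\mid s^k_h,a^k_h)$ the algorithm forms $$\widehat{\mathcal P}=\Big\{P\in\mathcal P:\ \ell_{\mathcal D}(P)\ge\sup_{Q\in\mathcal P}\ell_{\mathcal D}(Q)-\beta\Big\}$$ and outputs any $\hat\pi\in\arg\max_{\pi\in\Pi}\inf_{P\in\widehat{\mathcal P}}V^\pi_{0;P}(s_0)$. **Coverage.**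 For a comparator policy $\pi^*\in\Pi$ put $$C^{\pi^*}_{\mathcal D}=\max_{0\le h<H,\ P\in\mathcal P}\frac{\mathbb E_{(s,a)\sim d_h^{\pi^*}}\,\mathbb H^2\big(P(s,a)\,\|\,P^\star(s,a)\big)}{\frac1K\sum_{k=1}^K\mathbb H^2\big(P(s_h^k,a_h^k)\,\|\,P^\star(s_h^k,a_h^k)\big)}\in[0,\infty]$$ (a supremum, with $0/0=0$ and $x/0=\infty$ for $x>0$), where $\mathbb H^2$ is the squared Hellinger distance. **Theorem.** There is a universal constant $c>0$ such that, in every such setting: 1. With probability at least $1-\delta$, simultaneously for all outputs $\hat\pi$ and all $\pi^*\in\Pi$ with $C^{\pi^*}_{\mathcal D}<\infty$, $$V^{\pi^*}-V^{\hat\pi}\le c\left(\sqrt{\frac{C^{\pi^*}_{\mathcal D}\,\mathrm{Var}_{\pi^*}\,L}{K}}+\frac{C^{\pi^*}_{\mathcal D}\,L}{K}\right).$$ 2. Consequently, if $\pi^*\in\Pi$ and constants $C^{\pi^*}\ge0$, $\delta'\ge0$ satisfy $C^{\pi^*}_{\mathcal D}\le C^{\pi^*}$ with probability at least $1-\delta'$,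 then with probability at least $1-\delta-\delta'$ every output $\hat\pi$ satisfies $$V^{\pi^*}-V^{\hat\pi}\le c\left(\sqrt{\frac{C^{\pi^*}\,\mathrm{Var}_{\pi^*}\,L}{K}}+\frac{C^{\pi^*}\,L}{K}\right).$$ -/

import Mathlib

open MeasureTheory ProbabilityTheory
open scoped ENNReal

noncomputable section

namespace OfflineRL

variable {S A : Type*} [MeasurableSpace S] [MeasurableSpace A]

/-! ### Transition models -/

/-- A time-homogeneous transition model given by its densities `P(s' | s, a)` with respect to a
reference measure `ν` on the state space (counting measure on a finite state space, Lebesgue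
measure on a continuous one). The argument `(s, a, s')` stands for `P(s' | s, a)`. -/
structure Model (S A : Type*) [MeasurableSpace S] [MeasurableSpace A] (ν : Measure S) where
  density : S × A × S → ℝ
  measurable_density : Measurable density
  density_nonneg : ∀ x, 0 ≤ density x
  lintegral_density : ∀ s a, ∫⁻ s', ENNReal.ofReal (density (s, a, s')) ∂ν = 1

/-- The transition kernel `(s, a) ↦ P(s, a)` of a model. -/
def Model.kernel {ν : Measure S} [IsFiniteMeasure ν] (P : Model S A ν) : Kernel (S × A) S :=
  Kernel.withDensity (Kernel.const (S × A) ν)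
    (fun x s' => ENNReal.ofReal (P.density (x.1, x.2, s')))

theorem Model.measurable_ofReal_density {ν : Measure S} (P : Model S A ν) :
    Measurable (Function.uncurry fun (x : S × A) (s' : S) =>
      ENNReal.ofReal (P.density (x.1, x.2, s'))) :=
  ENNReal.measurable_ofReal.comp (P.measurable_density.comp (by fun_prop))

instance Model.isMarkovKernel_kernel {ν : Measure S} [IsFiniteMeasure ν] (P : Model S A ν) :
    IsMarkovKernel P.kernel := by
  refine ⟨fun x => ⟨?_⟩⟩
  rw [Model.kernel, Kernel.withDensity_apply _ P.measurable_ofReal_density,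
    withDensity_apply _ MeasurableSet.univ, Measure.restrict_univ, Kernel.const_apply]
  exact P.lintegral_density x.1 x.2

/-- Squared Hellinger distance `½ ∫ (√P(s'|s,a) - √Q(s'|s,a))² dν(s')` between `P(s, a)` and
`Q(s, a)`. -/
def hellingerSq {ν : Measure S} (P Q : Model S A ν) (x : S × A) : ℝ≥0∞ :=
  (∫⁻ s', ENNReal.ofReal
    ((√(P.density (x.1, x.2, s')) - √(Q.density (x.1, x.2, s'))) ^ 2) ∂ν) / 2

/-! ### Policies, trajectories, values -/

/-- Deterministic non-stationary policies. In a problem of horizon `H` only the entries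
`h < H` are ever used. -/
structure Policy (S A : Type*) [MeasurableSpace S] [MeasurableSpace A] where
  act : ℕ → S → A
  measurable_act : ∀ h, Measurable (act h)

/-- The one-step transition `s ↦ P(s, π_h(s))`. -/
def Policy.step {ν : Measure S} [IsFiniteMeasure ν] (P : Model S A ν) (π : Policy S A) (h : ℕ) :
    Kernel S S :=
  P.kernel.comap (fun s => (s, π.act h s)) (measurable_id.prodMk (π.measurable_act h))

instance Policy.isMarkovKernel_step {ν : Measure S} [IsFiniteMeasure ν] (P : Model S A ν)
    (π : Policy S A) (h : ℕ) : IsMarkovKernel (π.step P h) := by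
  unfold Policy.step; infer_instance

theorem measurable_consTrajectory (π : Policy S A) (h n : ℕ) :
    Measurable (fun x : S × (Fin n → S × A) =>
      (Fin.cons (x.1, π.act h x.1) x.2 : Fin (n + 1) → S × A)) := by
  refine measurable_pi_lambda _ fun i => ?_
  have := π.measurable_act h
  refine Fin.cases ?_ (fun j => ?_) i
  · simp only [Fin.cons_zero]; fun_prop
  · simp only [Fin.cons_succ]; fun_prop

/-- `trajectory P π n h s` is the law of `((s_h, a_h), …, (s_{h+n-1}, a_{h+n-1}))` when
`s_h = s`, `a_i = π_i(s_i)` and `s_{i+1} ∼ P(s_i, a_i)`. -/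
def trajectory {ν : Measure S} [IsFiniteMeasure ν] (P : Model S A ν) (π : Policy S A) :
    (n : ℕ) → ℕ → Kernel S (Fin n → S × A)
  | 0, _ => Kernel.deterministic (fun _ => Fin.elim0) measurable_const
  | n + 1, h =>
      (Kernel.id ×ₖ (trajectory P π n (h + 1) ∘ₖ π.step P h)).map
        (fun x => Fin.cons (x.1, π.act h x.1) x.2)

instance isMarkovKernel_trajectory {ν : Measure S} [IsFiniteMeasure ν] (P : Model S A ν)
    (π : Policy S A) (n h : ℕ) : IsMarkovKernel (trajectory P π n h) := by
  induction n generalizing h with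
  | zero => unfold trajectory; infer_instance
  | succ n ih =>
    have := ih (h + 1)
    unfold trajectory
    exact Kernel.IsMarkovKernel.map _ (measurable_consTrajectory π h n)

/-- Total reward `r(τ)` of a (piece of a) trajectory. -/
def totalReward (r : S × A → ℝ) {n : ℕ} (τ : Fin n → S × A) : ℝ := ∑ i, r (τ i)

/-- The value `V^π_{h;P}(s)`: expected total reward from step `h` to the end of the horizon `H`. -/
def value {ν : Measure S} [IsFiniteMeasure ν] (r : S × A → ℝ) (H : ℕ) (P : Model S A ν)
    (π : Policy S A) (h : ℕ) (s : S) : ℝ :=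
  ∫ τ, totalReward r τ ∂(trajectory P π (H - h) h s)

/-- `Var_π`: the variance of the total reward of a trajectory of `π`, started at `s₀`. -/
def returnVariance {ν : Measure S} [IsFiniteMeasure ν] (r : S × A → ℝ) (H : ℕ) (P : Model S A ν)
    (π : Policy S A) (s₀ : S) : ℝ :=
  variance (totalReward r) (trajectory P π H 0 s₀)

/-- The state-action distribution `d^π_h` of `π` at time step `h`. -/
def occupancy {ν : Measure S} [IsFiniteMeasure ν] {H : ℕ} (P : Model S A ν) (π : Policy S A)
    (s₀ : S) (h : Fin H) : Measure (S × A) :=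
  (trajectory P π H 0 s₀).map (fun τ => τ h)

/-! ### Offline data -/

/-- `K` trajectories `s_0, a_0, s_1, …, s_{H-1}, a_{H-1}, s_H`. -/
structure Dataset (S A : Type*) (K H : ℕ) where
  state : Fin K → Fin (H + 1) → S
  action : Fin K → Fin H → A

variable {Ω : Type*} {K H : ℕ}

/-- The history available when the next state after step `h` of trajectory `k` is drawn: all
earlier trajectories, and the states and actions of trajectory `k` up to step `h` inclusive. -/
@[reducible] def history (D : Ω → Dataset S A K H) (k : Fin K) (h : Fin H) : MeasurableSpace Ω :=
  (⨆ (j : Fin K) (_ : j < k) (i : Fin (H + 1)),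
      MeasurableSpace.comap (fun ω => (D ω).state j i) inferInstance) ⊔
    (⨆ (j : Fin K) (_ : j < k) (i : Fin H),
      MeasurableSpace.comap (fun ω => (D ω).action j i) inferInstance) ⊔
    (⨆ (i : Fin (H + 1)) (_ : i ≤ h.castSucc),
      MeasurableSpace.comap (fun ω => (D ω).state k i) inferInstance) ⊔
    (⨆ (i : Fin H) (_ : i ≤ h),
      MeasurableSpace.comap (fun ω => (D ω).action k i) inferInstance)

/-- Adversarially generated offline data: every trajectory starts at `s₀`, the actions are chosen
in an arbitrary (possibly randomized, history-dependent) way, and given the history the next state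
is drawn from the ground truth transition `Pstar(s_h^k, a_h^k)`. -/
structure IsOfflineData [MeasurableSpace Ω] {ν : Measure S} [IsFiniteMeasure ν] (μ : Measure Ω)
    (Pstar : Model S A ν) (s₀ : S) (D : Ω → Dataset S A K H) : Prop where
  measurable_state : ∀ k i, Measurable fun ω => (D ω).state k i
  measurable_action : ∀ k i, Measurable fun ω => (D ω).action k i
  initial : ∀ k, ∀ᵐ ω ∂μ, (D ω).state k 0 = s₀
  transition : ∀ (k : Fin K) (h : Fin H) (B : Set S), MeasurableSet B →
    μ⟦(fun ω => (D ω).state k h.succ) ⁻¹' B | history D k h⟧ =ᵐ[μ]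
      fun ω => (Pstar.kernel ((D ω).state k h.castSucc, (D ω).action k h)).real B

/-- The log-likelihood `∑_{k,h} log P(s_{h+1}^k | s_h^k, a_h^k)`, with `log 0 = -∞`. -/
def logLikelihood {ν : Measure S} (P : Model S A ν) (D : Dataset S A K H) : EReal :=
  ∑ k : Fin K, ∑ h : Fin H, ENNReal.log (ENNReal.ofReal
    (P.density (D.state k h.castSucc, D.action k h, D.state k h.succ)))

/-- The version space `{P ∈ 𝓜 : loglik(P) ≥ max_{Q ∈ 𝓜} loglik(Q) - β}`. -/
def versionSpace {ν : Measure S} (𝓜 : Set (Model S A ν)) (β : ℝ) (D : Dataset S A K H) :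
    Set (Model S A ν) :=
  {P | P ∈ 𝓜 ∧ (⨆ Q ∈ 𝓜, logLikelihood Q D) - (β : EReal) ≤ logLikelihood P D}

/-- `π` is a possible output of pessimistic planning in the version space:
`π ∈ argmax_π min_{P ∈ version space} V^π_{0;P}(s₀)`. -/
def IsPessimisticPolicy {ν : Measure S} [IsFiniteMeasure ν] (r : S × A → ℝ) (s₀ : S)
    (𝓜 : Set (Model S A ν)) (β : ℝ) (D : Dataset S A K H) (π : Policy S A) : Prop :=
  ∀ π' : Policy S A, (⨅ P : versionSpace 𝓜 β D, value r H P.1 π' 0 s₀) ≤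
    ⨅ P : versionSpace 𝓜 β D, value r H P.1 π 0 s₀

/-- The data-dependent single-policy concentrability coefficient
`max_{h, P ∈ 𝓜} E_{d^π_h} ℍ²(P ‖ P⋆) / ((1/K) ∑_k ℍ²(P ‖ P⋆)(s_h^k, a_h^k))`, with `0 / 0 = 0` and
`x / 0 = ∞` for `x > 0`. -/
def concentrability {ν : Measure S} [IsFiniteMeasure ν] (𝓜 : Set (Model S A ν))
    (Pstar : Model S A ν) (s₀ : S) (D : Dataset S A K H) (π : Policy S A) : ℝ≥0∞ :=
  ⨆ (h : Fin H) (P ∈ 𝓜),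
    (∫⁻ x, hellingerSq P Pstar x ∂(occupancy Pstar π s₀ h)) /
      ((∑ k : Fin K, hellingerSq P Pstar (D.state k h.castSucc, D.action k h)) / (K : ℝ≥0∞))

/-! ### Bracketing numbers -/

/-- The `ε`-bracketing number of `G` in the sup norm: the least number of brackets `[l, u]`
(`l ≤ u` pointwise) with `‖u - l‖_∞ ≤ ε` that cover `G`; it is `⊤` if no finite number does. -/
def bracketingNumber {X : Type*} (ε : ℝ) (G : Set (X → ℝ)) : ℕ∞ :=
  ⨅ (B : Set ((X → ℝ) × (X → ℝ)))
    (_ : (∀ b ∈ B, ∀ x, b.1 x ≤ b.2 x ∧ b.2 x - b.1 x ≤ ε) ∧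
      ∀ g ∈ G, ∃ b ∈ B, ∀ x, b.1 x ≤ g x ∧ g x ≤ b.2 x), B.encard

/-- The bracketing number `N_[]((K H |S|)⁻¹, 𝓜, ‖·‖_∞)` of a model class, where `|S| = ν(S)`. -/
def modelBracketingNumber {ν : Measure S} (K H : ℕ) (𝓜 : Set (Model S A ν)) : ℕ∞ :=
  bracketingNumber ((K : ℝ) * H * ν.real Set.univ)⁻¹ (Model.density '' 𝓜)

/-- The second-order rate `√(C · Var · L / K) + C · L / K`. -/
def secondOrderRate (C Var L : ℝ) (K : ℕ) : ℝ := √(C * Var * L / K) + C * L / K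

end OfflineRL

end

namespace OfflineRL

noncomputable section

variable {S A : Type*} [MeasurableSpace S] [MeasurableSpace A]

/-! ### Densities and Hellinger distance -/

/-! The argument has a statistical half and a planning half, linked by the Hellinger distance.

Statistics. For a fixed model `R`, the square root of the likelihood ratio of `R + ε` to the truth,
multiplied by `exp (ℍ² / 2)`, has conditional mean at most `exp (ε ν(S))` at each transition,
whatever the adversary plays. Multiplying along the data (`IsOfflineData.lintegral_prod_le`) gives
total mean at most `e` when `ε = (K H ν(S))⁻¹`. Markov's inequality and a union bound over a
sup-norm net then yield one event on which every likelihood gain over the truth, plus the cumulative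
Hellinger distance of the net point, is at most `2 (1 + L)`. Enlarging by `ε` makes the net point
dominate every model near it. On this event the truth lies in the version space, and each member has
cumulative Hellinger distance at most `26 L` from the truth along the data
(`IsOfflineData.exists_good_event`).

Planning. Coverage transfers the Hellinger bound from the data to the occupancies of the comparator.
A change of transition moves the mean of a bounded function by `l · variance + O(1 / l + 1) · ℍ²`
(`abs_integral_kernel_sub_le`). The variance that appears is that of the wrong model's value
function. The potential `|g| + 4 l g²` of the value gap `g` absorbs the excess over the true value's
variance, and the true one-step variances telescope to the variance of the return
(`gap_potential_le`). Optimizing over `l` gives the second-order bound. Pessimism requires it only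
for the comparator (`suboptimality_le`). -/

theorem integrable_of_abs_le {X : Type*} [MeasurableSpace X] {μ : Measure X} [IsFiniteMeasure μ]
    {f : X → ℝ} (hf : Measurable f) {C : ℝ} (hC : ∀ x, |f x| ≤ C) : Integrable f μ :=
  Integrable.of_bound hf.aestronglyMeasurable C
    (Filter.Eventually.of_forall fun x => (Real.norm_eq_abs _).trans_le (hC x))

theorem abs_integral_le_of_abs_le {X : Type*} [MeasurableSpace X] {μ : Measure X}
    [IsProbabilityMeasure μ] {f : X → ℝ} {C : ℝ} (hC : ∀ x, |f x| ≤ C) : |∫ x, f x ∂μ| ≤ C := by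
  simpa using norm_integral_le_of_norm_le_const (μ := μ)
    (Filter.Eventually.of_forall fun x => (Real.norm_eq_abs _).trans_le (hC x))

theorem integral_const_add_mul_add {X : Type*} [MeasurableSpace X] {μ : Measure X}
    [IsProbabilityMeasure μ] {f g : X → ℝ} (hf : Integrable f μ) (hg : Integrable g μ) (a b : ℝ) :
    ∫ x, (a + b * f x + g x) ∂μ = a + b * ∫ x, f x ∂μ + ∫ x, g x ∂μ := by
  have h : Integrable (fun x => a + b * f x) μ := (integrable_const a).add (hf.const_mul b)
  rw [integral_add h hg, integral_add (integrable_const a) (hf.const_mul b), integral_const_mul]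
  simp

namespace Model

variable {ν : Measure S} (P Q : Model S A ν)

theorem measurable_density_section (x : S × A) :
    Measurable fun s' => P.density (x.1, x.2, s') :=
  P.measurable_density.comp (by fun_prop)

theorem lintegral_section (x : S × A) :
    ∫⁻ s', ENNReal.ofReal (P.density (x.1, x.2, s')) ∂ν = 1 :=
  P.lintegral_density x.1 x.2

theorem integrable_section (x : S × A) : Integrable (fun s' => P.density (x.1, x.2, s')) ν := by
  rw [← lintegral_ofReal_ne_top_iff_integrable (P.measurable_density_section x).aestronglyMeasurable
    (Filter.Eventually.of_forall fun _ => P.density_nonneg _), P.lintegral_section]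
  exact ENNReal.one_ne_top

theorem integral_section (x : S × A) : ∫ s', P.density (x.1, x.2, s') ∂ν = 1 := by
  rw [integral_eq_lintegral_of_nonneg_ae (Filter.Eventually.of_forall fun _ => P.density_nonneg _)
    (P.measurable_density_section x).aestronglyMeasurable, P.lintegral_section, ENNReal.toReal_one]

variable [IsFiniteMeasure ν]

theorem kernel_apply_eq (x : S × A) :
    P.kernel x = ν.withDensity fun s' => ENNReal.ofReal (P.density (x.1, x.2, s')) := by
  rw [Model.kernel, Kernel.withDensity_apply _ P.measurable_ofReal_density, Kernel.const_apply]

theorem integral_kernel (x : S × A) (f : S → ℝ) :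
    ∫ s', f s' ∂(P.kernel x) = ∫ s', P.density (x.1, x.2, s') * f s' ∂ν := by
  rw [kernel_apply_eq, integral_withDensity_eq_integral_toReal_smul
    (P.measurable_density_section x).ennreal_ofReal (Filter.Eventually.of_forall fun _ => by simp)]
  refine integral_congr_ae (Filter.Eventually.of_forall fun s' => ?_)
  simp [ENNReal.toReal_ofReal (P.density_nonneg _)]

theorem lintegral_kernel (x : S × A) {f : S → ℝ≥0∞} (hf : Measurable f) :
    ∫⁻ s', f s' ∂(P.kernel x) =
      ∫⁻ s', ENNReal.ofReal (P.density (x.1, x.2, s')) * f s' ∂ν := by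
  rw [kernel_apply_eq, lintegral_withDensity_eq_lintegral_mul _
    (P.measurable_density_section x).ennreal_ofReal hf]
  rfl

end Model

theorem sq_sub_sqrt_le_add {a b : ℝ} (ha : 0 ≤ a) (hb : 0 ≤ b) : (√a - √b) ^ 2 ≤ a + b := by
  nlinarith [Real.sq_sqrt ha, Real.sq_sqrt hb, Real.sqrt_nonneg a, Real.sqrt_nonneg b,
    mul_nonneg (Real.sqrt_nonneg a) (Real.sqrt_nonneg b)]

section Hellinger

variable {ν : Measure S} (P Q : Model S A ν)

theorem measurable_hellingerSq [SFinite ν] : Measurable (hellingerSq P Q) := by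
  unfold hellingerSq
  refine Measurable.div_const ?_ _
  have h : Measurable fun y : (S × A) × S => ENNReal.ofReal
      ((√(P.density (y.1.1, y.1.2, y.2)) - √(Q.density (y.1.1, y.1.2, y.2))) ^ 2) := by
    have h1 := P.measurable_density.comp
      (by fun_prop : Measurable fun y : (S × A) × S => (y.1.1, y.1.2, y.2))
    have h2 := Q.measurable_density.comp
      (by fun_prop : Measurable fun y : (S × A) × S => (y.1.1, y.1.2, y.2))
    exact ((h1.sqrt.sub h2.sqrt).pow_const 2).ennreal_ofReal
  exact h.lintegral_prod_right'

theorem hellingerSq_le_one (x : S × A) : hellingerSq P Q x ≤ 1 := by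
  have h : ∫⁻ s', ENNReal.ofReal
      ((√(P.density (x.1, x.2, s')) - √(Q.density (x.1, x.2, s'))) ^ 2) ∂ν ≤ 2 := by
    calc _ ≤ ∫⁻ s', (ENNReal.ofReal (P.density (x.1, x.2, s')) +
          ENNReal.ofReal (Q.density (x.1, x.2, s'))) ∂ν := by
          refine lintegral_mono fun s' => ?_
          rw [← ENNReal.ofReal_add (P.density_nonneg _) (Q.density_nonneg _)]
          exact ENNReal.ofReal_le_ofReal
            (sq_sub_sqrt_le_add (P.density_nonneg _) (Q.density_nonneg _))
      _ = 2 := by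
          rw [lintegral_add_left (P.measurable_density_section x).ennreal_ofReal,
            P.lintegral_section, Q.lintegral_section]
          norm_num
  unfold hellingerSq
  exact (ENNReal.div_le_div_right h 2).trans (ENNReal.div_self two_ne_zero ENNReal.ofNat_ne_top).le

theorem hellingerSq_ne_top (x : S × A) : hellingerSq P Q x ≠ ⊤ :=
  ((hellingerSq_le_one P Q x).trans_lt ENNReal.one_lt_top).ne

theorem integrable_sq_sub_sqrt (x : S × A) : Integrable (fun s' =>
    (√(P.density (x.1, x.2, s')) - √(Q.density (x.1, x.2, s'))) ^ 2) ν := by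
  refine ((P.integrable_section x).add (Q.integrable_section x)).mono' ?_
    (Filter.Eventually.of_forall fun s' => ?_)
  · exact (((P.measurable_density_section x).sqrt.sub
      (Q.measurable_density_section x).sqrt).pow_const 2).aestronglyMeasurable
  · rw [Real.norm_of_nonneg (sq_nonneg _)]
    exact sq_sub_sqrt_le_add (P.density_nonneg _) (Q.density_nonneg _)

theorem toReal_hellingerSq (x : S × A) : (hellingerSq P Q x).toReal =
    (∫ s', (√(P.density (x.1, x.2, s')) - √(Q.density (x.1, x.2, s'))) ^ 2 ∂ν) / 2 := by
  rw [hellingerSq, ENNReal.toReal_div, integral_eq_lintegral_of_nonneg_ae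
    (Filter.Eventually.of_forall fun _ => sq_nonneg _)
    (integrable_sq_sub_sqrt P Q x).aestronglyMeasurable]
  simp

/-- Factor `p - q = 2 √q (√p - √q) + (√p - √q)²`. AM-GM with weight `l` treats the first term, and
`|a| ≤ 1` the second. Only `q` multiplies `a²`, so after integration the variance is taken under `Q`
alone. -/
theorem mul_sub_le_of_abs_le_one {a p q l : ℝ} (ha : |a| ≤ 1) (hp : 0 ≤ p) (hq : 0 ≤ q)
    (hl : 0 < l) : |a * (p - q)| ≤ l * (a ^ 2 * q) + (1 / l + 1) * (√p - √q) ^ 2 := by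
  obtain ⟨u, hu, rfl⟩ : ∃ u, 0 ≤ u ∧ u ^ 2 = p := ⟨√p, Real.sqrt_nonneg _, Real.sq_sqrt hp⟩
  obtain ⟨v, hv, rfl⟩ : ∃ v, 0 ≤ v ∧ v ^ 2 = q := ⟨√q, Real.sqrt_nonneg _, Real.sq_sqrt hq⟩
  rw [Real.sqrt_sq hu, Real.sqrt_sq hv]
  have e : a * (u ^ 2 - v ^ 2) = 2 * (a * v) * (u - v) + a * (u - v) ^ 2 := by ring
  have h1 : |a * (u - v) ^ 2| ≤ (u - v) ^ 2 := by
    rw [abs_mul, abs_of_nonneg (sq_nonneg (u - v))]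
    exact mul_le_of_le_one_left (sq_nonneg _) ha
  have h2 : |2 * (a * v) * (u - v)| ≤ l * (a ^ 2 * v ^ 2) + 1 / l * (u - v) ^ 2 := by
    have k1 : l * (a ^ 2 * v ^ 2) + 1 / l * (u - v) ^ 2 - 2 * (a * v) * (u - v)
        = (l * (a * v) - (u - v)) ^ 2 / l := by field_simp; ring
    have k2 : l * (a ^ 2 * v ^ 2) + 1 / l * (u - v) ^ 2 + 2 * (a * v) * (u - v)
        = (l * (a * v) + (u - v)) ^ 2 / l := by field_simp; ring
    have k3 : 0 ≤ (l * (a * v) - (u - v)) ^ 2 / l := by positivity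
    have k4 : 0 ≤ (l * (a * v) + (u - v)) ^ 2 / l := by positivity
    rw [abs_le]; constructor <;> linarith
  rw [e]
  exact (abs_add_le _ _).trans (by linarith)

/-- Expectations of a `[0, 1]`-valued function under two transitions differ by at most the variance
plus the squared Hellinger distance, with a free trade-off parameter. -/
theorem abs_integral_kernel_sub_le [IsFiniteMeasure ν] (x : S × A) {f : S → ℝ} (hf : Measurable f)
    (hf0 : ∀ s, f s ∈ Set.Icc (0 : ℝ) 1) {l : ℝ} (hl : 0 < l) :
    |∫ s', f s' ∂(P.kernel x) - ∫ s', f s' ∂(Q.kernel x)| ≤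
      l * (∫ s', f s' ^ 2 ∂(Q.kernel x) - (∫ s', f s' ∂(Q.kernel x)) ^ 2) +
        2 * (1 / l + 1) * (hellingerSq P Q x).toReal := by
  set m := ∫ s', f s' ∂(Q.kernel x) with hm
  have hm0 : m ∈ Set.Icc (0 : ℝ) 1 :=
    ⟨integral_nonneg fun s => (hf0 s).1, (le_abs_self _).trans
      (abs_integral_le_of_abs_le fun s => abs_le.2 ⟨by linarith [(hf0 s).1], (hf0 s).2⟩)⟩
  have hb : ∀ s, |f s - m| ≤ 1 := fun s =>
    abs_le.2 ⟨by linarith [(hf0 s).1, hm0.2], by linarith [(hf0 s).2, hm0.1]⟩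
  have hfi : ∀ R : Model S A ν, Integrable f (R.kernel x) := fun R =>
    integrable_of_abs_le hf (C := 1) fun s => abs_le.2 ⟨by linarith [(hf0 s).1], (hf0 s).2⟩
  have hgi : ∀ R : Model S A ν,
      Integrable (fun s' => R.density (x.1, x.2, s') * (f s' - m)) ν := fun R =>
    (R.integrable_section x).mul_of_top_left (memLp_top_of_bound
      (hf.sub_const m).aestronglyMeasurable 1 (Filter.Eventually.of_forall hb))
  have hg2 : Integrable (fun s' => Q.density (x.1, x.2, s') * (f s' - m) ^ 2) ν :=
    (Q.integrable_section x).mul_of_top_left (memLp_top_of_bound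
      ((hf.sub_const m).pow_const 2).aestronglyMeasurable 1 (Filter.Eventually.of_forall fun s => by
        rw [Real.norm_of_nonneg (sq_nonneg _), sq_le_one_iff_abs_le_one]; exact hb s))
  have e1 : ∀ R : Model S A ν, ∫ s', f s' ∂(R.kernel x) - m =
      ∫ s', R.density (x.1, x.2, s') * (f s' - m) ∂ν := fun R => by
    rw [← R.integral_kernel x, integral_sub (hfi R) (integrable_const _)]; simp
  -- Centring at the `Q`-mean is free because `f - m` integrates to zero under `Q`; it turns a
  -- second moment into a variance.
  have e2 : ∫ s', f s' ∂(P.kernel x) - m =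
      ∫ s', (f s' - m) * (P.density (x.1, x.2, s') - Q.density (x.1, x.2, s')) ∂ν := by
    have h := e1 Q
    rw [← hm, sub_self] at h
    rw [e1 P, ← sub_zero (∫ s', P.density _ * _ ∂ν), h, ← integral_sub (hgi P) (hgi Q)]
    congr 1; ext s'; ring
  have e3 : ∫ s', f s' ^ 2 ∂(Q.kernel x) - m ^ 2 =
      ∫ s', Q.density (x.1, x.2, s') * (f s' - m) ^ 2 ∂ν := by
    have hf2 : Integrable (fun s => f s ^ 2) (Q.kernel x) :=
      integrable_of_abs_le (hf.pow_const 2) (C := 1) fun s => by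
        rw [abs_of_nonneg (sq_nonneg _)]
        exact pow_le_one₀ (hf0 s).1 (hf0 s).2
    have h : ∀ s, (f s - m) ^ 2 = m ^ 2 + -(2 * m) * f s + f s ^ 2 := fun s => by ring
    rw [← Q.integral_kernel x]
    simp_rw [h]
    rw [integral_const_add_mul_add (hfi Q) hf2, ← hm]
    ring
  rw [e2, e3, toReal_hellingerSq]
  have hi := integrable_sq_sub_sqrt P Q x
  calc _ ≤ ∫ s', |(f s' - m) * (P.density (x.1, x.2, s') - Q.density (x.1, x.2, s'))| ∂ν :=
        abs_integral_le_integral_abs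
    _ ≤ ∫ s', (l * (Q.density (x.1, x.2, s') * (f s' - m) ^ 2) + (1 / l + 1) *
          (√(P.density (x.1, x.2, s')) - √(Q.density (x.1, x.2, s'))) ^ 2) ∂ν := by
        refine integral_mono_of_nonneg (Filter.Eventually.of_forall fun _ => abs_nonneg _)
          ((hg2.const_mul _).add (hi.const_mul _)) (Filter.Eventually.of_forall fun s' => ?_)
        have := mul_sub_le_of_abs_le_one (hb s') (P.density_nonneg (x.1, x.2, s'))
          (Q.density_nonneg (x.1, x.2, s')) hl
        simpa only [mul_comm (Q.density (x.1, x.2, s'))] using this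
    _ = _ := by
        rw [integral_add (hg2.const_mul _) (hi.const_mul _), integral_const_mul,
          integral_const_mul]
        ring

end Hellinger

/-! ### Bellman equations -/

section Bellman

theorem measurable_totalReward {r : S × A → ℝ} (hr : Measurable r) (n : ℕ) :
    Measurable (totalReward r : (Fin n → S × A) → ℝ) := by
  unfold totalReward; fun_prop

theorem abs_totalReward_le {S A : Type*} {r : S × A → ℝ} {C : ℝ} (hC : ∀ x, |r x| ≤ C) {n : ℕ}
    (τ : Fin n → S × A) : |totalReward r τ| ≤ n * C := by
  unfold totalReward
  calc _ ≤ ∑ i, |r (τ i)| := Finset.abs_sum_le_sum_abs _ _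
    _ ≤ ∑ _i : Fin n, C := Finset.sum_le_sum fun i _ => hC _
    _ = n * C := by simp

theorem totalReward_cons {S A : Type*} (r : S × A → ℝ) {n : ℕ} (x : S × A) (τ : Fin n → S × A) :
    totalReward r (Fin.cons x τ : Fin (n + 1) → S × A) = r x + totalReward r τ := by
  simp [totalReward, Fin.sum_univ_succ]

variable {ν : Measure S} [IsFiniteMeasure ν] (P Q : Model S A ν) (π : Policy S A)

theorem trajectory_succ_apply (n h : ℕ) (s : S) : trajectory P π (n + 1) h s =
    ((trajectory P π n (h + 1) ∘ₖ π.step P h) s).map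
      (fun τ => (Fin.cons (s, π.act h s) τ : Fin (n + 1) → S × A)) := by
  have hm := measurable_consTrajectory (S := S) π h n
  rw [trajectory, Kernel.map_apply _ hm, Kernel.prod_apply, Kernel.id_apply, Measure.dirac_prod,
    Measure.map_map hm measurable_prodMk_left]
  rfl

theorem integral_trajectory_succ (n h : ℕ) (s : S) {F : (Fin (n + 1) → S × A) → ℝ}
    (hF : Measurable F) {C : ℝ} (hC : ∀ τ, |F τ| ≤ C) :
    ∫ τ, F τ ∂(trajectory P π (n + 1) h s) =
      ∫ s', ∫ τ, F (Fin.cons (s, π.act h s) τ) ∂(trajectory P π n (h + 1) s')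
        ∂(π.step P h s) := by
  have hm : Measurable fun τ : Fin n → S × A =>
      (Fin.cons (s, π.act h s) τ : Fin (n + 1) → S × A) :=
    (measurable_consTrajectory (S := S) π h n).comp measurable_prodMk_left
  rw [trajectory_succ_apply, integral_map hm.aemeasurable hF.aestronglyMeasurable,
    Kernel.integral_comp]
  exact integrable_of_abs_le (hF.comp hm) fun _ => hC _

variable (r : S × A → ℝ)

/-- Expected total reward of the next `n` steps, from step `h` and state `s`. -/
def stepValue (n h : ℕ) (s : S) : ℝ := ∫ τ, totalReward r τ ∂(trajectory P π n h s)

/-- Second moment of the total reward of the next `n` steps, from step `h` and state `s`. -/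
def stepSecondMoment (n h : ℕ) (s : S) : ℝ :=
  ∫ τ, totalReward r τ ^ 2 ∂(trajectory P π n h s)

variable {r}

theorem measurable_integral_kernel {X Y : Type*} [MeasurableSpace X] [MeasurableSpace Y]
    (κ : Kernel X Y) {f : Y → ℝ} (hf : Measurable f) : Measurable fun x => ∫ y, f y ∂(κ x) :=
  hf.stronglyMeasurable.integral_kernel.measurable

theorem measurable_stepValue (hr : Measurable r) (n h : ℕ) :
    Measurable (stepValue P π r n h) :=
  measurable_integral_kernel _ (measurable_totalReward hr n)

theorem measurable_stepSecondMoment (hr : Measurable r) (n h : ℕ) :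
    Measurable (stepSecondMoment P π r n h) :=
  measurable_integral_kernel _ ((measurable_totalReward hr n).pow_const 2)

variable {C : ℝ}

theorem abs_stepValue_le (hC : ∀ x, |r x| ≤ C) (n h : ℕ) (s : S) :
    |stepValue P π r n h s| ≤ n * C :=
  abs_integral_le_of_abs_le (abs_totalReward_le hC)

theorem abs_totalReward_sq_le {S A : Type*} {r : S × A → ℝ} {C : ℝ} (hC : ∀ x, |r x| ≤ C)
    {n : ℕ} (τ : Fin n → S × A) : |totalReward r τ ^ 2| ≤ (n * C) ^ 2 := by
  rw [abs_pow]
  exact pow_le_pow_left₀ (abs_nonneg _) (abs_totalReward_le hC τ) 2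

theorem abs_stepSecondMoment_le (hC : ∀ x, |r x| ≤ C) (n h : ℕ) (s : S) :
    |stepSecondMoment P π r n h s| ≤ (n * C) ^ 2 :=
  abs_integral_le_of_abs_le (abs_totalReward_sq_le hC)

theorem stepValue_zero (h : ℕ) (s : S) : stepValue P π r 0 h s = 0 := by
  simp [stepValue, totalReward]

theorem stepSecondMoment_zero (h : ℕ) (s : S) : stepSecondMoment P π r 0 h s = 0 := by
  simp [stepSecondMoment, totalReward]

theorem integrable_totalReward (hr : Measurable r) (hC : ∀ x, |r x| ≤ C) (n : ℕ)
    (μ : Measure (Fin n → S × A)) [IsFiniteMeasure μ] : Integrable (totalReward r) μ :=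
  integrable_of_abs_le (measurable_totalReward hr n) (abs_totalReward_le hC)

theorem integrable_stepValue (hr : Measurable r) (hC : ∀ x, |r x| ≤ C) (n h : ℕ) (μ : Measure S)
    [IsFiniteMeasure μ] : Integrable (stepValue P π r n h) μ :=
  integrable_of_abs_le (measurable_stepValue P π hr n h) (abs_stepValue_le P π hC n h)

theorem stepValue_succ (hr : Measurable r) (hC : ∀ x, |r x| ≤ C) (n h : ℕ) (s : S) :
    stepValue P π r (n + 1) h s =
      r (s, π.act h s) + ∫ s', stepValue P π r n (h + 1) s' ∂(π.step P h s) := by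
  rw [stepValue, integral_trajectory_succ P π n h s (measurable_totalReward hr _)
    (abs_totalReward_le hC)]
  have e : ∀ s', ∫ τ, totalReward r (Fin.cons (s, π.act h s) τ : Fin (n + 1) → S × A)
      ∂(trajectory P π n (h + 1) s') =
      r (s, π.act h s) + stepValue P π r n (h + 1) s' := fun s' => by
    simp_rw [totalReward_cons]
    rw [integral_add (integrable_const _) (integrable_totalReward hr hC _ _)]
    simp [stepValue]
  simp_rw [e]
  rw [integral_add (integrable_const _) (integrable_stepValue P π hr hC _ _ _)]
  simp

theorem stepSecondMoment_succ (hr : Measurable r) (hC : ∀ x, |r x| ≤ C) (n h : ℕ) (s : S) :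
    stepSecondMoment P π r (n + 1) h s =
      r (s, π.act h s) ^ 2 +
        2 * r (s, π.act h s) * ∫ s', stepValue P π r n (h + 1) s' ∂(π.step P h s) +
        ∫ s', stepSecondMoment P π r n (h + 1) s' ∂(π.step P h s) := by
  rw [stepSecondMoment, integral_trajectory_succ P π n h s
    ((measurable_totalReward hr _).pow_const 2) (abs_totalReward_sq_le hC)]
  have e : ∀ s', ∫ τ, totalReward r (Fin.cons (s, π.act h s) τ : Fin (n + 1) → S × A) ^ 2
      ∂(trajectory P π n (h + 1) s') =
      r (s, π.act h s) ^ 2 + 2 * r (s, π.act h s) * stepValue P π r n (h + 1) s' +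
        stepSecondMoment P π r n (h + 1) s' := fun s' => by
    simp_rw [totalReward_cons, add_sq]
    exact integral_const_add_mul_add (integrable_totalReward hr hC _ _)
      (integrable_of_abs_le ((measurable_totalReward hr n).pow_const 2)
        (abs_totalReward_sq_le hC)) _ _
  simp_rw [e]
  exact integral_const_add_mul_add (integrable_stepValue P π hr hC _ _ _)
    (integrable_of_abs_le (measurable_stepSecondMoment P π hr n _)
      (abs_stepSecondMoment_le P π hC n _)) _ _

end Bellman

/-! ### Second-order simulation lemma -/

section Simulation

theorem sq_integral_le {X : Type*} [MeasurableSpace X] {μ : Measure X} [IsProbabilityMeasure μ]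
    {f : X → ℝ} (hf : Integrable f μ) (hf2 : Integrable (fun x => f x ^ 2) μ) :
    (∫ x, f x ∂μ) ^ 2 ≤ ∫ x, f x ^ 2 ∂μ := by
  set m := ∫ x, f x ∂μ with hm
  have h : 0 ≤ ∫ x, (m ^ 2 + -(2 * m) * f x + f x ^ 2) ∂μ :=
    integral_nonneg fun x => by
      simp only [Pi.zero_apply]; nlinarith [sq_nonneg (f x - m)]
  rw [integral_const_add_mul_add hf hf2, ← hm] at h
  linarith

/-- One backward step of the second-order simulation lemma. Here `g`, `b` are the value gap and the
one-step model error, `σ`, `ξ` are one-step variances of the two value functions, and primes denote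
expectations of the corresponding quantities at the next step. -/
theorem simulation_step_arith {l g b σ ξ Eabs Eg Eg2 D : ℝ} (hl : 0 < l) (hg : |g| ≤ 1)
    (hgb : g = b + Eg) (hEg : |Eg| ≤ Eabs) (hξ : ξ ≤ 2 * σ + 2 * (Eg2 - Eg ^ 2))
    (hb : ∀ l : ℝ, 0 < l → |b| ≤ l * ξ + 2 * (1 / l + 1) * D) :
    |g| + 4 * l * g ^ 2 ≤ Eabs + 4 * l * Eg2 + 4 * l * σ + (144 * l + 2 + 2 / l) * D := by
  -- The weight `1 / 8` is chosen so that the term `4 |b|` arising in the bound on `ξ` costs only `ξ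
  -- / 2`, which is absorbed on the left.
  have h1 : |b| ≤ ξ / 8 + 18 * D := by
    have := hb (1 / 8) (by norm_num)
    norm_num at this
    linarith
  have hgb' : |g * b| ≤ |b| := by
    rw [abs_mul]; exact mul_le_of_le_one_left (abs_nonneg b) hg
  have h2 : Eg2 - Eg ^ 2 ≤ Eg2 - g ^ 2 + 2 * |b| := by
    have : Eg = g - b := by linarith
    rw [this]
    nlinarith [le_abs_self (g * b), sq_nonneg b]
  have h3 : ξ ≤ 4 * σ + 4 * (Eg2 - g ^ 2) + 144 * D := by linarith
  have h4 : l * ξ ≤ l * (4 * σ + 4 * (Eg2 - g ^ 2) + 144 * D) :=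
    mul_le_mul_of_nonneg_left h3 hl.le
  have h5 := hb l hl
  have h6 : |g| ≤ |b| + |Eg| := hgb ▸ abs_add_le b Eg
  have h7 : 2 * (1 / l + 1) * D = (2 + 2 / l) * D := by ring
  rw [h7] at h5
  nlinarith

variable {ν : Measure S} [IsFiniteMeasure ν] (P Q : Model S A ν) (π : Policy S A)
  {r : S × A → ℝ} {H : ℕ}

/-- The squared Hellinger distance as a real-valued function. -/
def hellingerReal (x : S × A) : ℝ := (hellingerSq P Q x).toReal

theorem measurable_hellingerReal : Measurable (hellingerReal P Q) :=
  (measurable_hellingerSq P Q).ennreal_toReal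

theorem hellingerReal_nonneg {ν : Measure S} (P Q : Model S A ν) (x : S × A) : 0 ≤ hellingerReal P Q x := ENNReal.toReal_nonneg

theorem abs_hellingerReal_le {ν : Measure S} (P Q : Model S A ν) (x : S × A) : |hellingerReal P Q x| ≤ 1 := by
  rw [abs_of_nonneg (hellingerReal_nonneg P Q x)]
  exact ENNReal.toReal_le_of_le_ofReal zero_le_one (by simpa using hellingerSq_le_one P Q x)

/-- Backward induction. The gap splits into the one-step model error on the value of `P` and the
`Q`-mean of the next gap. By the law of total variance, the variance of the remaining reward under
`Q` is the mean of its successor plus the one-step variance of the value; the reward cancels. The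
quadratic part of the potential pays for having the variance of `w` in place of that of `v`. -/
theorem gap_potential_le (hr : Measurable r) (hr1 : ∀ x, |r x| ≤ 1)
    (hP : ∀ n h, n + h = H → ∀ s, stepValue P π r n h s ∈ Set.Icc (0 : ℝ) 1)
    (hQ : ∀ n h, n + h = H → ∀ s, stepValue Q π r n h s ∈ Set.Icc (0 : ℝ) 1)
    {l : ℝ} (hl : 0 < l) (n h : ℕ) (hn : n + h = H) (s : S) :
    |stepValue P π r n h s - stepValue Q π r n h s| +
        4 * l * (stepValue P π r n h s - stepValue Q π r n h s) ^ 2 ≤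
      4 * l * (stepSecondMoment Q π r n h s - stepValue Q π r n h s ^ 2) +
        (144 * l + 2 + 2 / l) * stepValue Q π (hellingerReal P Q) n h s := by
  induction n generalizing h s with
  | zero => simp [stepValue_zero, stepSecondMoment_zero]
  | succ n ih =>
    have hn' : n + (h + 1) = H := by omega
    have hg1 : |stepValue P π r (n + 1) h s - stepValue Q π r (n + 1) h s| ≤ 1 := by
      have h1 := hP _ h hn s
      have h2 := hQ _ h hn s
      exact abs_le.2 ⟨by linarith [h1.1, h2.2], by linarith [h1.2, h2.1]⟩
    have hD := measurable_hellingerReal P Q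
    have hD1 := abs_hellingerReal_le P Q
    rw [stepValue_succ P π hr hr1, stepValue_succ Q π hr hr1] at hg1 ⊢
    rw [stepSecondMoment_succ Q π hr hr1, stepValue_succ Q π hD hD1]
    have hv := hQ n (h + 1) hn'
    have hw := hP n (h + 1) hn'
    have hvm := measurable_stepValue Q π hr n (h + 1)
    have hwm := measurable_stepValue P π hr n (h + 1)
    have ih' := ih (h + 1) hn'
    have hMm := measurable_stepSecondMoment Q π hr n (h + 1)
    have hMb := abs_stepSecondMoment_le Q π hr1 n (h + 1)
    have hΔi := integrable_stepValue Q π hD hD1 n (h + 1) (π.step Q h s)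
    have hstepP : π.step P h s = P.kernel (s, π.act h s) := rfl
    have hstepQ : π.step Q h s = Q.kernel (s, π.act h s) := rfl
    rw [hstepQ] at hΔi
    rw [hstepP, hstepQ] at hg1 ⊢
    set x := (s, π.act h s)
    set v := stepValue Q π r n (h + 1)
    set w := stepValue P π r n (h + 1)
    set M := stepSecondMoment Q π r n (h + 1)
    set Δ := stepValue Q π (hellingerReal P Q) n (h + 1)
    have hv1 : ∀ s, |v s| ≤ 1 := fun s => abs_le.2 ⟨by linarith [(hv s).1], (hv s).2⟩
    have hw1 : ∀ s, |w s| ≤ 1 := fun s => abs_le.2 ⟨by linarith [(hw s).1], (hw s).2⟩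
    have hgb : ∀ s, |w s - v s| ≤ 1 := fun s =>
      abs_le.2 ⟨by linarith [(hw s).1, (hv s).2], by linarith [(hw s).2, (hv s).1]⟩
    have hsq : ∀ f : S → ℝ, Measurable f → (∀ s, |f s| ≤ 1) →
        Integrable (fun s => f s ^ 2) (Q.kernel x) := fun f hf hf1 =>
      integrable_of_abs_le (hf.pow_const 2) (C := 1) fun s => by
        rw [abs_of_nonneg (sq_nonneg _)]; exact (sq_le_one_iff_abs_le_one _).2 (hf1 s)
    have iv : Integrable v (Q.kernel x) := integrable_of_abs_le hvm hv1
    have iw : Integrable w (Q.kernel x) := integrable_of_abs_le hwm hw1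
    have iv2 := hsq v hvm hv1
    have iw2 := hsq w hwm hw1
    have ig2 := hsq (fun s => w s - v s) (hwm.sub hvm) hgb
    have iM : Integrable M (Q.kernel x) := integrable_of_abs_le hMm hMb
    have iabs : Integrable (fun s => |w s - v s|) (Q.kernel x) := (iw.sub iv).abs
    have hEg : ∫ s, (w s - v s) ∂(Q.kernel x) =
        ∫ s, w s ∂(Q.kernel x) - ∫ s, v s ∂(Q.kernel x) := integral_sub iw iv
    -- Parallelogram law for variances applied to `v` and `w - v`: the discarded term is the
    -- nonnegative variance of `v - (w - v) = 2 v - w`.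
    have hξ : ∫ s, w s ^ 2 ∂(Q.kernel x) - (∫ s, w s ∂(Q.kernel x)) ^ 2 ≤
        2 * (∫ s, v s ^ 2 ∂(Q.kernel x) - (∫ s, v s ∂(Q.kernel x)) ^ 2) +
        2 * (∫ s, (w s - v s) ^ 2 ∂(Q.kernel x) - (∫ s, (w s - v s) ∂(Q.kernel x)) ^ 2) := by
      have j := sq_integral_le (μ := Q.kernel x) (f := fun s => 2 * v s - w s)
        ((iv.const_mul 2).sub iw) (by
          have : (fun s => (2 * v s - w s) ^ 2) =
              fun s => 2 * v s ^ 2 + 2 * (w s - v s) ^ 2 - w s ^ 2 := by ext s; ring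
          rw [this]
          exact ((iv2.const_mul 2).add (ig2.const_mul 2)).sub iw2)
      have e : ∫ s, (2 * v s - w s) ^ 2 ∂(Q.kernel x) = 2 * ∫ s, v s ^ 2 ∂(Q.kernel x) +
          2 * ∫ s, (w s - v s) ^ 2 ∂(Q.kernel x) - ∫ s, w s ^ 2 ∂(Q.kernel x) := by
        have i1 : Integrable (fun s => 2 * v s ^ 2 + 2 * (w s - v s) ^ 2) (Q.kernel x) :=
          (iv2.const_mul 2).add (ig2.const_mul 2)
        rw [← integral_const_mul, ← integral_const_mul,
          ← integral_add (iv2.const_mul 2) (ig2.const_mul 2), ← integral_sub i1 iw2]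
        congr 1; ext s; ring
      rw [e, integral_sub (iv.const_mul 2) iw, integral_const_mul] at j
      rw [hEg]
      nlinarith
    have key := simulation_step_arith hl hg1
      (b := ∫ s, w s ∂(P.kernel x) - ∫ s, w s ∂(Q.kernel x)) (D := hellingerReal P Q x)
      (Eg := ∫ s, (w s - v s) ∂(Q.kernel x)) (by rw [hEg]; ring)
      (abs_integral_le_integral_abs) hξ
      (fun l hl => abs_integral_kernel_sub_le P Q x hwm hw hl)
    have hint : ∫ s, |w s - v s| ∂(Q.kernel x) + 4 * l * ∫ s, (w s - v s) ^ 2 ∂(Q.kernel x) ≤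
        4 * l * (∫ s, M s ∂(Q.kernel x) - ∫ s, v s ^ 2 ∂(Q.kernel x)) +
          (144 * l + 2 + 2 / l) * ∫ s, Δ s ∂(Q.kernel x) := by
      have i1 : Integrable (fun s => 4 * l * (M s - v s ^ 2)) (Q.kernel x) :=
        (iM.sub iv2).const_mul _
      rw [← integral_sub iM iv2, ← integral_const_mul, ← integral_const_mul, ← integral_const_mul,
        ← integral_add iabs (ig2.const_mul _), ← integral_add i1 (hΔi.const_mul _)]
      exact integral_mono (iabs.add (ig2.const_mul _)) (i1.add (hΔi.const_mul _)) ih'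
    have hDx : hellingerReal P Q (s, π.act h s) = hellingerReal P Q x := rfl
    rw [hDx]
    linarith

/-- If `y ≤ 4 λ V + (144 λ + 2 + 2 / λ) Δ` for every `λ > 0` and `Δ ≤ c B`, then `y` is at most a
multiple of `√(B V) + B`. -/
theorem le_sqrt_add_of_forall_pos {y V Δ B c : ℝ} (hV : 0 ≤ V) (hB : 0 ≤ B) (hc : 0 ≤ c)
    (hΔ : Δ ≤ c * B) (h : ∀ l : ℝ, 0 < l → y ≤ 4 * l * V + (144 * l + 2 + 2 / l) * Δ) :
    y ≤ (4 + 148 * c) * (√(B * V) + B) := by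
  have h' : ∀ l : ℝ, 0 < l → y ≤ 4 * l * V + (144 * l + 2 + 2 / l) * (c * B) := fun l hl =>
    (h l hl).trans (by gcongr)
  rcases hB.eq_or_lt with rfl | hB0
  · simp only [mul_zero, add_zero, zero_mul, Real.sqrt_zero] at h' ⊢
    refine le_of_forall_pos_le_add fun e he => ?_
    -- With `B = 0` only `4 l V` is left, so `l` tends to zero; `V + 1` avoids dividing by `V = 0`.
    have := h' (e / (4 * (V + 1))) (by positivity)
    have e1 : 4 * (e / (4 * (V + 1))) * V = e * (V / (V + 1)) := by field_simp
    have e2 : V / (V + 1) ≤ 1 := by rw [div_le_one (by linarith)]; linarith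
    rw [e1] at this
    nlinarith
  rcases le_or_gt V B with hVB | hVB
  · have := h' 1 one_pos
    have h0 := Real.sqrt_nonneg (B * V)
    nlinarith [mul_nonneg hc h0]
  · have hV0 : 0 < V := hB0.trans hVB
    obtain ⟨b, hb, rfl⟩ : ∃ b, 0 < b ∧ b ^ 2 = B := ⟨√B, Real.sqrt_pos.2 hB0, Real.sq_sqrt hB⟩
    obtain ⟨v, hv, rfl⟩ : ∃ v, 0 < v ∧ v ^ 2 = V := ⟨√V, Real.sqrt_pos.2 hV0, Real.sq_sqrt hV⟩
    have hbv : b < v := lt_of_pow_lt_pow_left₀ 2 hv.le hVB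
    have e : √(b ^ 2 * v ^ 2) = b * v := by rw [← mul_pow, Real.sqrt_sq (by positivity)]
    -- The balancing choice `l = √(B / V)`, which is below `1` in this case.
    have := h' (b / v) (by positivity)
    have e1 : 4 * (b / v) * v ^ 2 = 4 * (b * v) := by field_simp
    have e2 : 2 / (b / v) * (c * b ^ 2) = 2 * c * (b * v) := by field_simp
    have e3 : b / v ≤ 1 := (div_le_one hv).2 hbv.le
    have e4 : 144 * (b / v) * (c * b ^ 2) ≤ 144 * (c * b ^ 2) := by
      have := mul_le_mul_of_nonneg_right e3 (by positivity : 0 ≤ 144 * (c * b ^ 2))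
      linarith
    rw [e]
    have h1 : 0 ≤ c * (b * v) := by positivity
    have h2 : 0 ≤ c * b ^ 2 := by positivity
    nlinarith [sq_nonneg b]

/-! ### Values, variances and occupancies -/

theorem value_eq_stepValue (h : ℕ) (s : S) :
    value r H P π h s = stepValue P π r (H - h) h s := rfl

theorem returnVariance_eq (hr : Measurable r) (hr1 : ∀ x, |r x| ≤ 1) (s : S) :
    returnVariance r H P π s = stepSecondMoment P π r H 0 s - stepValue P π r H 0 s ^ 2 := by
  rw [returnVariance, variance_eq_sub]
  · rfl
  · exact MemLp.of_bound (measurable_totalReward hr H).aestronglyMeasurable (H * 1)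
      (Filter.Eventually.of_forall fun τ => (Real.norm_eq_abs _).trans_le
        (abs_totalReward_le hr1 τ))

/-- The cumulative Hellinger distance is a value function with reward `ℍ²`, which lets the Bellman
equation serve for it too. -/
theorem stepValue_hellingerReal_eq (R : Model S A ν) (s : S) :
    stepValue R π (hellingerReal P Q) H 0 s =
      (∑ h : Fin H, ∫⁻ x, hellingerSq P Q x ∂(occupancy R π s h)).toReal := by
  have hm := measurable_hellingerSq P Q
  have e : ∀ h : Fin H, ∫⁻ x, hellingerSq P Q x ∂(occupancy R π s h) =
      ∫⁻ τ, hellingerSq P Q (τ h) ∂(trajectory R π H 0 s) := fun h => by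
    rw [occupancy, lintegral_map hm (measurable_pi_apply h)]
  simp_rw [e]
  have e' := lintegral_finsetSum (μ := trajectory R π H 0 s) (Finset.univ : Finset (Fin H))
    (f := fun h τ => hellingerSq P Q (τ h)) fun h _ => hm.comp (measurable_pi_apply h)
  rw [← e', stepValue]
  unfold totalReward
  rw [integral_eq_lintegral_of_nonneg_ae
      (Filter.Eventually.of_forall fun τ => Finset.sum_nonneg fun i _ => hellingerReal_nonneg P Q _)
      (measurable_totalReward (measurable_hellingerReal P Q) H).aestronglyMeasurable]
  congr 1
  refine lintegral_congr fun τ => ?_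
  rw [ENNReal.ofReal_sum_of_nonneg fun i _ => hellingerReal_nonneg P Q _]
  exact Finset.sum_congr rfl fun i _ => ENNReal.ofReal_toReal (hellingerSq_ne_top P Q _)

/-- If all values of a model lie in `[0, 1]`, so do the rewards. -/
theorem reward_mem_Icc (hr : Measurable r) (hH : 0 < H)
    (hP : ∀ (π : Policy S A) (h : ℕ), h ≤ H → ∀ s : S, value r H P π h s ∈ Set.Icc (0 : ℝ) 1)
    (x : S × A) : r x ∈ Set.Icc (0 : ℝ) 1 := by
  -- At the last step, the policy that always plays `x.2` collects exactly `r x`.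
  have h := hP ⟨fun _ _ => x.2, fun _ => measurable_const⟩ (H - 1) (by omega) x.1
  have e : H - (H - 1) = 0 + 1 := by omega
  have hm := measurable_totalReward (S := S) (A := A) hr 1
  rw [value, e, trajectory_succ_apply, integral_map] at h
  · simpa [totalReward] using h
  · exact ((measurable_consTrajectory (S := S) _ _ 0).comp measurable_prodMk_left).aemeasurable
  · exact hm.aestronglyMeasurable

/-- Second-order simulation lemma: if `∑_h E_{d_h} ℍ²(P ‖ Q) ≤ c B`, then the value gap between the
two models is at most a multiple of `√(B Var) + B`. -/
theorem value_sub_value_le (hr : Measurable r) (hH : 0 < H)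
    (hP : ∀ (π : Policy S A) (h : ℕ), h ≤ H → ∀ s : S, value r H P π h s ∈ Set.Icc (0 : ℝ) 1)
    (hQ : ∀ (π : Policy S A) (h : ℕ), h ≤ H → ∀ s : S, value r H Q π h s ∈ Set.Icc (0 : ℝ) 1)
    (s : S) {B c : ℝ} (hB : 0 ≤ B) (hc : 0 ≤ c)
    (hΔ : ∑ h : Fin H, ∫⁻ x, hellingerSq P Q x ∂(occupancy Q π s h) ≤ ENNReal.ofReal (c * B)) :
    value r H Q π 0 s - value r H P π 0 s ≤
      (4 + 148 * c) * (√(B * returnVariance r H Q π s) + B) := by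
  have hr1 : ∀ x, |r x| ≤ 1 := fun x => by
    have := reward_mem_Icc P hr hH hP x
    exact abs_le.2 ⟨by linarith [this.1], this.2⟩
  have aux : ∀ R : Model S A ν, (∀ (π : Policy S A) (h : ℕ), h ≤ H → ∀ s : S,
      value r H R π h s ∈ Set.Icc (0 : ℝ) 1) →
      ∀ n h, n + h = H → ∀ s, stepValue R π r n h s ∈ Set.Icc (0 : ℝ) 1 :=
    fun R hR n h hn s => by
      have := hR π h (by omega) s
      rwa [value_eq_stepValue, (by omega : H - h = n)] at this
  refine le_sqrt_add_of_forall_pos (variance_nonneg _ _) hB hc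
    (Δ := stepValue Q π (hellingerReal P Q) H 0 s) ?_ fun l hl => ?_
  · rw [stepValue_hellingerReal_eq]
    exact ENNReal.toReal_le_of_le_ofReal (by positivity) hΔ
  · have := gap_potential_le P Q π hr hr1 (aux P hP) (aux Q hQ) hl H 0 (by omega) s
    rw [← returnVariance_eq Q π hr hr1] at this
    rw [value_eq_stepValue, value_eq_stepValue, Nat.sub_zero]
    have h1 := neg_abs_le (stepValue P π r H 0 s - stepValue Q π r H 0 s)
    have h2 : 0 ≤ 4 * l * (stepValue P π r H 0 s - stepValue Q π r H 0 s) ^ 2 := by positivity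
    linarith

end Simulation

/-! ### Product bounds along adversarial data -/

section Supermartingale

/-- If `Y` has conditional law `κ (X)` given `m`, and `f (x, ·)` has mean at most `C` under `κ x`,
then multiplying an `m`-measurable `G ≥ 0` by `f (X, Y)` increases its mean at most by a
factor `C`. -/
theorem lintegral_mul_le_of_condExp {Ω X Y : Type*} {m mΩ : MeasurableSpace Ω}
    [MeasurableSpace X] [MeasurableSpace Y] (hm : m ≤ mΩ) {μ : Measure Ω} [IsProbabilityMeasure μ]
    {x : Ω → X} (hx : Measurable[m] x) {y : Ω → Y} (hy : Measurable y) (κ : Kernel X Y)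
    [IsMarkovKernel κ]
    (h : ∀ B, MeasurableSet B → μ⟦y ⁻¹' B | m⟧ =ᵐ[μ] fun ω => (κ (x ω)).real B)
    {G : Ω → ℝ≥0∞} (hG : Measurable[m] G) {f : X × Y → ℝ≥0∞} (hf : Measurable f) {C : ℝ≥0∞}
    (hC : ∀ a, ∫⁻ b, f (a, b) ∂(κ a) ≤ C) :
    ∫⁻ ω, G ω * f (x ω, y ω) ∂μ ≤ (∫⁻ ω, G ω ∂μ) * C := by
  have hxΩ : Measurable x := hx.mono hm le_rfl
  have hGΩ : Measurable G := hG.mono hm le_rfl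
  -- The hypothesis concerns events only. Carrying `G` along with `x` identifies the joint law with
  -- `y` as a composition product, after which Tonelli's theorem applies.
  set W : Ω → ℝ≥0∞ × X := fun ω => (G ω, x ω) with hW
  have hWm : Measurable[m] W := hG.prodMk hx
  have hWΩ : Measurable W := hGΩ.prodMk hxΩ
  set η : Kernel (ℝ≥0∞ × X) Y := κ.comap Prod.snd measurable_snd with hη
  have hlaw : μ.map (fun ω => (W ω, y ω)) = (μ.map W) ⊗ₘ η := by
    have := Measure.isProbabilityMeasure_map (μ := μ) hWΩ.aemeasurable
    have := Measure.isProbabilityMeasure_map (μ := μ) (hWΩ.prodMk hy).aemeasurable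
    refine Measure.ext_prod fun {E B} hE hB => ?_
    rw [Measure.map_apply (hWΩ.prodMk hy) (hE.prod hB), Measure.compProd_apply_prod hE hB,
      setLIntegral_map hE (Kernel.measurable_coe _ hB) hWΩ]
    have hpre : (fun ω => (W ω, y ω)) ⁻¹' E ×ˢ B = W ⁻¹' E ∩ y ⁻¹' B := rfl
    have hκm : Measurable fun ω => (κ (x ω)).real B :=
      ((Kernel.measurable_coe κ hB).comp hxΩ).ennreal_toReal
    have e : μ.real (W ⁻¹' E ∩ y ⁻¹' B) = ∫ ω in W ⁻¹' E, (κ (x ω)).real B ∂μ := by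
      rw [← setIntegral_congr_ae (hWΩ hE) ((h B hB).mono fun _ hω _ => hω),
        setIntegral_condExp hm ((integrable_const _).indicator (hy hB)) (hWm hE),
        setIntegral_indicator (hy hB)]
      simp
    rw [hpre, ← ENNReal.ofReal_toReal (measure_ne_top μ _)]
    change ENNReal.ofReal (μ.real _) = _
    rw [e, ofReal_integral_eq_lintegral_ofReal]
    · refine lintegral_congr fun ω => ?_
      rw [ofReal_measureReal]; rfl
    · exact (integrable_of_abs_le hκm (C := 1) fun ω => by
        rw [abs_of_nonneg measureReal_nonneg]; exact measureReal_le_one).integrableOn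
    · exact Filter.Eventually.of_forall fun _ => measureReal_nonneg
  set F : (ℝ≥0∞ × X) × Y → ℝ≥0∞ := fun t => t.1.1 * f (t.1.2, t.2) with hF
  have hFm : Measurable F := by
    have := hf.comp (by fun_prop : Measurable fun t : (ℝ≥0∞ × X) × Y => (t.1.2, t.2))
    exact (measurable_fst.comp measurable_fst).mul this
  calc ∫⁻ ω, G ω * f (x ω, y ω) ∂μ = ∫⁻ t, F t ∂(μ.map fun ω => (W ω, y ω)) := by
        rw [lintegral_map hFm (hWΩ.prodMk hy)]
    _ = ∫⁻ t, ∫⁻ b, F (t, b) ∂(η t) ∂(μ.map W) := by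
        rw [hlaw, Measure.lintegral_compProd hFm]
    _ ≤ ∫⁻ t, t.1 * C ∂(μ.map W) := by
        refine lintegral_mono fun t => ?_
        have hm' : Measurable fun b => f (t.2, b) := hf.comp measurable_prodMk_left
        simp only [hF]
        rw [lintegral_const_mul _ hm']
        exact mul_le_mul_right (hC t.2) _
    _ = (∫⁻ ω, G ω ∂μ) * C := by
        rw [lintegral_map (measurable_fst.mul_const C) hWΩ, lintegral_mul_const _ hGΩ]

variable {Ω : Type*} {K H : ℕ} (D : Ω → Dataset S A K H)

theorem measurable_state_history_of_lt {j k : Fin K} (hjk : j < k) (h : Fin H) (i : Fin (H + 1)) :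
    Measurable[history D k h] fun ω => (D ω).state j i :=
  Measurable.of_comap_le <| le_sup_of_le_left <| le_sup_of_le_left <| le_sup_of_le_left <|
    le_iSup₂_of_le j hjk <| le_iSup_of_le i le_rfl

theorem measurable_action_history_of_lt {j k : Fin K} (hjk : j < k) (h i : Fin H) :
    Measurable[history D k h] fun ω => (D ω).action j i :=
  Measurable.of_comap_le <| le_sup_of_le_left <| le_sup_of_le_left <| le_sup_of_le_right <|
    le_iSup₂_of_le j hjk <| le_iSup_of_le i le_rfl

theorem measurable_state_history_self (k : Fin K) {h : Fin H} {i : Fin (H + 1)}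
    (hi : i ≤ h.castSucc) : Measurable[history D k h] fun ω => (D ω).state k i :=
  Measurable.of_comap_le <| le_sup_of_le_left <| le_sup_of_le_right <| le_iSup₂_of_le i hi le_rfl

theorem measurable_action_history_self (k : Fin K) {h i : Fin H} (hi : i ≤ h) :
    Measurable[history D k h] fun ω => (D ω).action k i :=
  Measurable.of_comap_le <| le_sup_of_le_right <| le_iSup₂_of_le i hi le_rfl

/-- The state-action pair at step `i.2` of trajectory `i.1`. -/
def Dataset.pair {S A : Type*} {K H : ℕ} (d : Dataset S A K H) (i : Fin K × Fin H) : S × A :=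
  (d.state i.1 i.2.castSucc, d.action i.1 i.2)

/-- The state after step `i.2` of trajectory `i.1`. -/
def Dataset.next {S A : Type*} {K H : ℕ} (d : Dataset S A K H) (i : Fin K × Fin H) : S :=
  d.state i.1 i.2.succ

/-- The transitions that precede transition `(k, h)` are part of its history. -/
theorem measurable_transition_history {j k : Fin K} {i h : Fin H} (hlt : j < k ∨ j = k ∧ i < h) :
    Measurable[history D k h] fun ω => ((D ω).pair (j, i), (D ω).next (j, i)) := by
  rcases hlt with hjk | ⟨rfl, hih⟩
  · exact ((measurable_state_history_of_lt D hjk h _).prodMk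
      (measurable_action_history_of_lt D hjk h i)).prodMk
      (measurable_state_history_of_lt D hjk h _)
  · exact ((measurable_state_history_self D j (Fin.castSucc_le_castSucc_iff.2 hih.le)).prodMk
      (measurable_action_history_self D j hih.le)).prodMk
      (measurable_state_history_self D j (Fin.succ_le_castSucc_iff.2 hih))

variable {D}
variable [MeasurableSpace Ω] {ν : Measure S} [IsFiniteMeasure ν] {μ : Measure Ω}
  {Q : Model S A ν} {s₀ : S}

theorem IsOfflineData.history_le (hD : IsOfflineData μ Q s₀ D) (k : Fin K) (h : Fin H) :
    history D k h ≤ (inferInstance : MeasurableSpace Ω) := by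
  refine sup_le (sup_le (sup_le ?_ ?_) ?_) ?_
  · exact iSup_le fun j => iSup_le fun _ => iSup_le fun i => (hD.measurable_state j i).comap_le
  · exact iSup_le fun j => iSup_le fun _ => iSup_le fun i => (hD.measurable_action j i).comap_le
  · exact iSup_le fun i => iSup_le fun _ => (hD.measurable_state k i).comap_le
  · exact iSup_le fun i => iSup_le fun _ => (hD.measurable_action k i).comap_le

theorem IsOfflineData.measurable_next (hD : IsOfflineData μ Q s₀ D) (i : Fin K × Fin H) :
    Measurable fun ω => (D ω).next i :=
  hD.measurable_state _ _

theorem IsOfflineData.measurable_pair (hD : IsOfflineData μ Q s₀ D) (i : Fin K × Fin H) :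
    Measurable fun ω => (D ω).pair i :=
  (hD.measurable_state _ _).prodMk (hD.measurable_action _ _)

theorem divNat_lt_or_eq_modNat_lt {a b : Fin (K * H)} (hab : a < b) :
    a.divNat < b.divNat ∨ a.divNat = b.divNat ∧ a.modNat < b.modNat := by
  have hab' : a.val < b.val := hab
  simp only [Fin.lt_def, Fin.ext_iff, Fin.coe_divNat, Fin.coe_modNat]
  rcases (Nat.div_le_div_right (c := H) hab'.le).lt_or_eq with h | h
  · exact .inl h
  · refine .inr ⟨h, ?_⟩
    have h1 := Nat.div_add_mod a.val H
    have h2 := Nat.div_add_mod b.val H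
    rw [h] at h1
    omega

/-- If `f (x, ·)` has mean at most `C` under every transition of the ground truth, the product of
`f` over all transitions of the data has mean at most `C ^ (K H)`. -/
theorem IsOfflineData.lintegral_prod_le [IsProbabilityMeasure μ] (hD : IsOfflineData μ Q s₀ D)
    {f : (S × A) × S → ℝ≥0∞} (hf : Measurable f) {C : ℝ≥0∞}
    (hC : ∀ x, ∫⁻ s', f (x, s') ∂(Q.kernel x) ≤ C) :
    ∫⁻ ω, ∏ i : Fin K × Fin H, f ((D ω).pair i, (D ω).next i) ∂μ ≤ C ^ (K * H) := by
  -- Transitions are numbered in time order, trajectory by trajectory, so each prefix product is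
  -- measurable for the history of the next transition.
  set Z : Fin (K * H) → Ω → ℝ≥0∞ := fun n ω =>
    f ((D ω).pair (n.divNat, n.modNat), (D ω).next (n.divNat, n.modNat)) with hZ
  have hprod : ∀ ω, ∏ i : Fin K × Fin H, f ((D ω).pair i, (D ω).next i) = ∏ n, Z n ω := fun ω =>
    (Fintype.prod_equiv finProdFinEquiv.symm _ _ fun n => rfl).symm
  simp_rw [hprod]
  have main : ∀ m ≤ K * H, ∫⁻ ω, ∏ n with n.val < m, Z n ω ∂μ ≤ C ^ m := by
    intro m
    induction m with
    | zero => simp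
    | succ m ih =>
      intro hm
      set n₀ : Fin (K * H) := ⟨m, hm⟩ with hn₀
      have hins : (Finset.univ.filter fun n : Fin (K * H) => n.val < m + 1) =
          insert n₀ (Finset.univ.filter fun n : Fin (K * H) => n.val < m) := by
        ext n; simp [hn₀, Fin.ext_iff]; omega
      have hni : n₀ ∉ Finset.univ.filter fun n : Fin (K * H) => n.val < m := by simp [hn₀]
      have hG : Measurable[history D n₀.divNat n₀.modNat] fun ω =>
          ∏ n with n.val < m, Z n ω := by
        refine Finset.measurable_fun_prod _ fun n hn => hf.comp (measurable_transition_history D ?_)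
        exact divNat_lt_or_eq_modNat_lt (Fin.lt_def.2 (Finset.mem_filter.1 hn).2)
      have hx : Measurable[history D n₀.divNat n₀.modNat] fun ω =>
          (D ω).pair (n₀.divNat, n₀.modNat) :=
        (measurable_state_history_self D _ le_rfl).prodMk (measurable_action_history_self D _ le_rfl)
      have := lintegral_mul_le_of_condExp (hD.history_le _ _) hx 
        (hD.measurable_next (n₀.divNat, n₀.modNat)) Q.kernel
        (hD.transition n₀.divNat n₀.modNat) hG hf hC
      simp_rw [hins, Finset.prod_insert hni, pow_succ, mul_comm (Z n₀ _)]
      exact this.trans (mul_le_mul_left (ih (by omega)) C)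
  have := main (K * H) le_rfl
  simpa using this

end Supermartingale

/-! ### Sup-norm nets from brackets -/

/-- Bracket endpoints need be neither measurable nor densities, so each bracket that meets the class
is represented by a member of the class inside it. Two functions in one bracket differ by at most
its width. -/
theorem exists_finset_net {ν : Measure S} {𝓜 : Set (Model S A ν)} (hne : 𝓜.Nonempty) {ε : ℝ}
    {N : ℕ} (h : bracketingNumber ε (Model.density '' 𝓜) = N) :
    ∃ T : Finset (Model S A ν), T.card ≤ N ∧
      ∀ P ∈ 𝓜, ∃ R ∈ T, ∀ x, |P.density x - R.density x| ≤ ε := by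
  classical
  have hlt : bracketingNumber ε (Model.density '' 𝓜) < (N + 1 : ℕ) := by
    rw [h]; exact_mod_cast Nat.lt_succ_self N
  simp only [bracketingNumber, iInf_lt_iff] at hlt
  obtain ⟨B, ⟨hB1, hB2⟩, hBN⟩ := hlt
  have hfin : B.Finite := Set.finite_of_encard_le_coe hBN.le
  let F : ((S × A × S → ℝ) × (S × A × S → ℝ)) → Model S A ν := fun b =>
    if hb : ∃ P ∈ 𝓜, ∀ x, b.1 x ≤ P.density x ∧ P.density x ≤ b.2 x then hb.choose
    else hne.choose
  refine ⟨hfin.toFinset.image F, Finset.card_image_le.trans ?_, fun P hP => ?_⟩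
  · rw [hfin.encard_eq_coe_toFinset_card] at hBN
    exact Nat.lt_succ_iff.1 (by exact_mod_cast hBN)
  · obtain ⟨b, hb, hbP⟩ := hB2 _ ⟨P, hP, rfl⟩
    have hex : ∃ P ∈ 𝓜, ∀ x, b.1 x ≤ P.density x ∧ P.density x ≤ b.2 x := ⟨P, hP, hbP⟩
    refine ⟨F b, Finset.mem_image_of_mem F (hfin.mem_toFinset.2 hb), fun x => ?_⟩
    have hF : F b = hex.choose := dif_pos hex
    have h1 := hex.choose_spec.2 x
    rw [← hF] at h1
    have h2 := hbP x
    have h3 := (hB1 b hb x).2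
    exact abs_le.2 ⟨by linarith, by linarith⟩

/-! ### Likelihood ratios and Hellinger distance -/

section Likelihood

/-- Complete the square in `√(p + e) - √q`, then replace `√(p + e)` by `√p`, using `(√(p + e) - √p)²
≤ e`. -/
theorem sqrt_mul_sqrt_add_le {p q e : ℝ} (hp : 0 ≤ p) (hq : 0 ≤ q) (he : 0 ≤ e) :
    √(p + e) * √q + (√p - √q) ^ 2 / 4 ≤ p / 2 + q / 2 + e := by
  have h1 := Real.sq_sqrt (add_nonneg hp he)
  have h2 := Real.sq_sqrt hp
  have h3 := Real.sq_sqrt hq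
  have h4 : √p ≤ √(p + e) := Real.sqrt_le_sqrt (by linarith)
  have h5 := Real.sqrt_nonneg p
  have h6 : (√(p + e) - √p) ^ 2 ≤ e := by nlinarith
  nlinarith [sq_nonneg ((√(p + e) - √q) + (√(p + e) - √p))]

theorem sq_sub_sqrt_le_of_abs_sub_le {p p' q e : ℝ} (hp : 0 ≤ p) (hp' : 0 ≤ p')
    (h : |p - p'| ≤ e) : (√p - √q) ^ 2 ≤ 2 * (√p' - √q) ^ 2 + 2 * e := by
  have h2 := Real.sq_sqrt hp
  have h3 := Real.sq_sqrt hp'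
  have h4 := Real.sqrt_nonneg p
  have h5 := Real.sqrt_nonneg p'
  have h6 : (√p - √p') ^ 2 ≤ e := by
    rcases le_total (√p) (√p') with hle | hle
    · nlinarith [neg_abs_le (p - p')]
    · nlinarith [le_abs_self (p - p')]
  nlinarith [sq_nonneg ((√p - √p') - (√p' - √q))]

variable {ν : Measure S} [IsFiniteMeasure ν] (P R Q : Model S A ν)

theorem hellingerReal_le_of_abs_sub_le {ε : ℝ} (h : ∀ x, |P.density x - R.density x| ≤ ε)
    (x : S × A) : hellingerReal P Q x ≤ 2 * hellingerReal R Q x + ε * ν.real Set.univ := by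
  have hi := integrable_sq_sub_sqrt R Q x
  have := integral_mono (integrable_sq_sub_sqrt P Q x)
    ((hi.const_mul 2).add (integrable_const (2 * ε)))
    fun s' => sq_sub_sqrt_le_of_abs_sub_le (P.density_nonneg _) (R.density_nonneg _)
      (h (x.1, x.2, s'))
  simp only [Pi.add_apply] at this
  rw [integral_add (hi.const_mul 2) (integrable_const _), integral_const_mul, integral_const,
    smul_eq_mul] at this
  rw [hellingerReal, hellingerReal, toReal_hellingerSq, toReal_hellingerSq]
  linarith

/-- The square root of the likelihood ratio of an `ε`-enlarged density to the ground truth,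
compensated by the squared Hellinger distance. -/
def hellingerWeight (ε : ℝ) (y : (S × A) × S) : ℝ≥0∞ :=
  (ENNReal.ofReal (R.density (y.1.1, y.1.2, y.2) + ε) /
      ENNReal.ofReal (Q.density (y.1.1, y.1.2, y.2))) ^ (1 / 2 : ℝ) *
    ENNReal.ofReal (Real.exp (hellingerReal R Q y.1 / 2))

theorem measurable_hellingerWeight (ε : ℝ) : Measurable (hellingerWeight R Q ε) := by
  have h1 := R.measurable_density.comp
    (by fun_prop : Measurable fun y : (S × A) × S => (y.1.1, y.1.2, y.2))
  have h2 := Q.measurable_density.comp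
    (by fun_prop : Measurable fun y : (S × A) × S => (y.1.1, y.1.2, y.2))
  have h3 := (measurable_hellingerReal R Q).comp
    (measurable_fst : Measurable fun y : (S × A) × S => y.1)
  exact (((h1.add_const ε).ennreal_ofReal.div h2.ennreal_ofReal).pow_const _).mul
    (Real.measurable_exp.comp (h3.div_const 2)).ennreal_ofReal

theorem integral_sqrt_mul_sqrt_le {ε : ℝ} (hε : 0 ≤ ε) (x : S × A) :
    Integrable (fun s' => √(R.density (x.1, x.2, s') + ε) * √(Q.density (x.1, x.2, s'))) ν ∧
    ∫ s', √(R.density (x.1, x.2, s') + ε) * √(Q.density (x.1, x.2, s')) ∂ν ≤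
      1 + ε * ν.real Set.univ - hellingerReal R Q x / 2 := by
  have hbd : Integrable (fun s' => R.density (x.1, x.2, s') / 2 + Q.density (x.1, x.2, s') / 2 + ε)
      ν := (((R.integrable_section x).div_const 2).add ((Q.integrable_section x).div_const 2)).add
        (integrable_const ε)
  have hpt := fun s' => sqrt_mul_sqrt_add_le (R.density_nonneg (x.1, x.2, s'))
    (Q.density_nonneg (x.1, x.2, s')) hε
  have hi : Integrable (fun s' =>
      √(R.density (x.1, x.2, s') + ε) * √(Q.density (x.1, x.2, s'))) ν := by
    refine hbd.mono' ?_ (Filter.Eventually.of_forall fun s' => ?_)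
    · exact (((R.measurable_density_section x).add_const ε).sqrt.mul
        (Q.measurable_density_section x).sqrt).aestronglyMeasurable
    · rw [Real.norm_of_nonneg (by positivity)]
      nlinarith [hpt s', sq_nonneg (√(R.density (x.1, x.2, s')) - √(Q.density (x.1, x.2, s')))]
  refine ⟨hi, ?_⟩
  have hh := (integrable_sq_sub_sqrt R Q x).div_const 4
  have := integral_mono (hi.add hh) hbd hpt
  simp only [Pi.add_apply] at this
  have hRQ : Integrable (fun s' => R.density (x.1, x.2, s') / 2 + Q.density (x.1, x.2, s') / 2) ν :=
    ((R.integrable_section x).div_const 2).add ((Q.integrable_section x).div_const 2)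
  rw [integral_add hi hh, integral_add hRQ (integrable_const ε),
    integral_add ((R.integrable_section x).div_const 2) ((Q.integrable_section x).div_const 2),
    integral_div, integral_div, integral_div, R.integral_section, Q.integral_section,
    integral_const, smul_eq_mul] at this
  rw [hellingerReal, toReal_hellingerSq]
  linarith

/-- Where `q` vanishes the ratio may be `⊤`, but its weight is `0`; this is why an inequality
suffices. -/
theorem ofReal_mul_rpow_half_div_le {u q : ℝ} (hu : 0 ≤ u) :
    ENNReal.ofReal q * (ENNReal.ofReal u / ENNReal.ofReal q) ^ (1 / 2 : ℝ) ≤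
      ENNReal.ofReal (√u * √q) := by
  rcases le_or_gt q 0 with hq | hq
  · simp [ENNReal.ofReal_eq_zero.2 hq]
  · rw [← ENNReal.ofReal_div_of_pos hq, ENNReal.ofReal_rpow_of_nonneg (by positivity) (by norm_num),
      ← ENNReal.ofReal_mul hq.le, ← Real.sqrt_eq_rpow, Real.sqrt_div hu]
    refine ENNReal.ofReal_le_ofReal (le_of_eq ?_)
    have h := Real.mul_self_sqrt hq.le
    have h0 : √q ≠ 0 := (Real.sqrt_pos.2 hq).ne'
    field_simp
    rw [sq, h, mul_comm]

/-- The affinity is at most `1 + ε ν(S) - ℍ² / 2`, hence at most the exponential of `ε ν(S) - ℍ² /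
2`, and the compensating factor cancels `ℍ²`. -/
theorem lintegral_hellingerWeight_le {ε : ℝ} (hε : 0 ≤ ε) (x : S × A) :
    ∫⁻ s', hellingerWeight R Q ε (x, s') ∂(Q.kernel x) ≤
      ENNReal.ofReal (Real.exp (ε * ν.real Set.univ)) := by
  obtain ⟨hi, hle⟩ := integral_sqrt_mul_sqrt_le R Q hε x
  set c := Real.exp (hellingerReal R Q x / 2) with hc
  have hm : Measurable fun s' => hellingerWeight R Q ε (x, s') :=
    (measurable_hellingerWeight R Q ε).comp measurable_prodMk_left
  rw [Q.lintegral_kernel x hm]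
  calc _ ≤ ∫⁻ s', ENNReal.ofReal (√(R.density (x.1, x.2, s') + ε) * √(Q.density (x.1, x.2, s'))) *
          ENNReal.ofReal c ∂ν := by
        refine lintegral_mono fun s' => ?_
        simp only [hellingerWeight]
        rw [← mul_assoc]
        exact mul_le_mul_left
          (ofReal_mul_rpow_half_div_le (add_nonneg (R.density_nonneg _) hε)) _
    _ = ENNReal.ofReal ((∫ s', √(R.density (x.1, x.2, s') + ε) * √(Q.density (x.1, x.2, s')) ∂ν)
          * c) := by
        rw [lintegral_mul_const' _ _ ENNReal.ofReal_ne_top, ENNReal.ofReal_mul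
          (integral_nonneg fun _ => by positivity),
          ofReal_integral_eq_lintegral_ofReal hi (Filter.Eventually.of_forall fun _ => by positivity)]
    _ ≤ _ := by
        refine ENNReal.ofReal_le_ofReal ?_
        calc _ ≤ Real.exp (ε * ν.real Set.univ - hellingerReal R Q x / 2) * c := by
              refine mul_le_mul_of_nonneg_right (hle.trans ?_) (Real.exp_pos _).le
              linarith [Real.add_one_le_exp (ε * ν.real Set.univ - hellingerReal R Q x / 2)]
          _ = _ := by rw [hc, ← Real.exp_add]; congr 1; ring

/-- A bound on a product of weights `√(u / q) exp (h / 2)` turns into a bound on log-likelihoods. -/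
theorem sum_log_le_of_prod_lt {ι : Type*} [Fintype ι] {u q h : ι → ℝ} (hu : ∀ i, 0 < u i) {T : ℝ}
    (hT : ∏ i, ((ENNReal.ofReal (u i) / ENNReal.ofReal (q i)) ^ (1 / 2 : ℝ) *
      ENNReal.ofReal (Real.exp (h i / 2))) < ENNReal.ofReal T) :
    (∀ i, 0 < q i) ∧
      ∑ i, Real.log (u i) + ∑ i, h i ≤ 2 * Real.log T + ∑ i, Real.log (q i) := by
  classical
  set w : ι → ℝ≥0∞ := fun i => (ENNReal.ofReal (u i) / ENNReal.ofReal (q i)) ^ (1 / 2 : ℝ) *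
      ENNReal.ofReal (Real.exp (h i / 2)) with hw
  have hw0 : ∀ i, w i ≠ 0 := fun i => by
    refine mul_ne_zero ?_ (by simpa using Real.exp_pos _)
    have : ENNReal.ofReal (u i) / ENNReal.ofReal (q i) ≠ 0 :=
      (ENNReal.div_pos (by simpa using hu i) ENNReal.ofReal_ne_top).ne'
    simp [ENNReal.rpow_eq_zero_iff, this]
  -- A zero of `q` makes one factor `⊤` while no factor vanishes, contradicting finiteness of the
  -- product.
  have hq : ∀ i, 0 < q i := fun i => by
    by_contra hi
    have h1 : ENNReal.ofReal (q i) = 0 := ENNReal.ofReal_eq_zero.2 (not_lt.1 hi)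
    have h2 : w i = ⊤ := by
      simp only [hw, h1]
      rw [ENNReal.div_zero (by simpa using hu i), ENNReal.top_rpow_of_pos (by norm_num),
        ENNReal.top_mul (by simpa using Real.exp_pos _)]
    have h3 : ∏ j, w j = ⊤ := by
      rw [← Finset.mul_prod_erase _ _ (Finset.mem_univ i), h2,
        ENNReal.top_mul (Finset.prod_ne_zero_iff.2 fun j _ => hw0 j)]
    rw [h3] at hT
    exact not_top_lt hT
  refine ⟨hq, ?_⟩
  have hwr : ∀ i, w i = ENNReal.ofReal (√(u i / q i) * Real.exp (h i / 2)) := fun i => by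
    simp only [hw]
    rw [← ENNReal.ofReal_div_of_pos (hq i), ENNReal.ofReal_rpow_of_nonneg
      (div_nonneg (hu i).le (hq i).le) (by norm_num), ← Real.sqrt_eq_rpow,
      ← ENNReal.ofReal_mul (Real.sqrt_nonneg _)]
  have hpos : ∀ i, 0 < √(u i / q i) * Real.exp (h i / 2) := fun i =>
    mul_pos (Real.sqrt_pos.2 (div_pos (hu i) (hq i))) (Real.exp_pos _)
  simp_rw [hwr] at hT
  rw [← ENNReal.ofReal_prod_of_nonneg fun i _ => (hpos i).le] at hT
  have hT' := (ENNReal.ofReal_lt_ofReal_iff_of_nonneg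
    (Finset.prod_nonneg fun i _ => (hpos i).le)).1 hT
  have hlog := Real.log_le_log (Finset.prod_pos fun i _ => hpos i) hT'.le
  rw [Real.log_prod fun i _ => (hpos i).ne'] at hlog
  have e : ∀ i, Real.log (√(u i / q i) * Real.exp (h i / 2)) =
      (Real.log (u i) - Real.log (q i) + h i) / 2 := fun i => by
    rw [Real.log_mul (Real.sqrt_pos.2 (div_pos (hu i) (hq i))).ne' (Real.exp_ne_zero _),
      Real.log_exp, Real.log_sqrt (div_pos (hu i) (hq i)).le,
      Real.log_div (hu i).ne' (hq i).ne']
    ring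
  simp_rw [e] at hlog
  rw [← Finset.sum_div, Finset.sum_add_distrib, Finset.sum_sub_distrib] at hlog
  linarith

end Likelihood

/-! ### Log-likelihoods as real sums -/

section LogLikelihood

variable {ν : Measure S} (P : Model S A ν) {K H : ℕ} (d : Dataset S A K H)

/-- The density at transition `i` of the data. -/
def dataDensity (i : Fin K × Fin H) : ℝ := P.density ((d.pair i).1, (d.pair i).2, d.next i)

theorem coe_sum_ereal {ι : Type*} (s : Finset ι) (f : ι → ℝ) :
    ((∑ i ∈ s, f i : ℝ) : EReal) = ∑ i ∈ s, (f i : EReal) := by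
  classical
  induction s using Finset.induction_on with
  | empty => simp
  | insert i s hi ih => rw [Finset.sum_insert hi, Finset.sum_insert hi, EReal.coe_add, ih]

theorem logLikelihood_eq_sum : logLikelihood P d =
    ∑ i : Fin K × Fin H, ENNReal.log (ENNReal.ofReal (dataDensity P d i)) := by
  rw [Fintype.sum_prod_type]; rfl

theorem logLikelihood_eq_coe (h : ∀ i, 0 < dataDensity P d i) :
    logLikelihood P d = ((∑ i, Real.log (dataDensity P d i) : ℝ) : EReal) := by
  rw [logLikelihood_eq_sum, coe_sum_ereal]
  exact Finset.sum_congr rfl fun i _ => ENNReal.log_ofReal_of_pos (h i)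

theorem logLikelihood_le_coe {u : Fin K × Fin H → ℝ} (hu : ∀ i, 0 < u i)
    (h : ∀ i, dataDensity P d i ≤ u i) :
    logLikelihood P d ≤ ((∑ i, Real.log (u i) : ℝ) : EReal) := by
  rw [logLikelihood_eq_sum, coe_sum_ereal]
  refine Finset.sum_le_sum fun i _ => ?_
  rw [← ENNReal.log_ofReal_of_pos (hu i)]
  exact ENNReal.log_le_log (ENNReal.ofReal_le_ofReal (h i))

end LogLikelihood

/-! ### Maximum likelihood guarantee and policy suboptimality -/

section MLE

variable {Ω : Type*} [MeasurableSpace Ω] {ν : Measure S} [IsFiniteMeasure ν] {μ : Measure Ω}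
  [IsProbabilityMeasure μ] {K H : ℕ} {Q : Model S A ν} {s₀ : S} {D : Ω → Dataset S A K H}

/-- The product of the Hellinger weights of `R` over all transitions of the data. -/
def weightProduct (R Q : Model S A ν) (ε : ℝ) (d : Dataset S A K H) : ℝ≥0∞ :=
  ∏ i : Fin K × Fin H, hellingerWeight R Q ε (d.pair i, d.next i)

theorem IsOfflineData.measure_le_weightProduct_le (hD : IsOfflineData μ Q s₀ D) (R : Model S A ν)
    {ε : ℝ} (hε : 0 ≤ ε) (hε1 : K * H * ν.real Set.univ * ε ≤ 1) {T : ℝ} (hT : 0 < T) :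
    μ {ω | ENNReal.ofReal T ≤ weightProduct R Q ε (D ω)} ≤ ENNReal.ofReal (Real.exp 1 / T) := by
  have hm : Measurable fun ω => weightProduct R Q ε (D ω) :=
    Finset.measurable_fun_prod _ fun i _ => (measurable_hellingerWeight R Q ε).comp
      ((hD.measurable_pair i).prodMk (hD.measurable_next i))
  refine (meas_ge_le_lintegral_div hm.aemeasurable (by simpa using hT)
    ENNReal.ofReal_ne_top).trans ?_
  rw [ENNReal.ofReal_div_of_pos hT]
  refine ENNReal.div_le_div_right ((hD.lintegral_prod_le (measurable_hellingerWeight R Q ε)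
    (lintegral_hellingerWeight_le R Q hε)).trans ?_) _
  rw [← ENNReal.ofReal_pow (Real.exp_pos _).le, ← Real.exp_nat_mul]
  refine ENNReal.ofReal_le_ofReal (Real.exp_le_exp.2 (le_trans (le_of_eq ?_) hε1))
  push_cast
  ring

/-- The threshold `5 / 8` is what `5 + 18 L ≤ 26 L` requires. -/
theorem log_two_gt_five_eighths : (5 / 8 : ℝ) < Real.log 2 := by
  linarith [Real.log_two_gt_d9]

theorem mem_versionSpace_of_weightProduct_lt {ν : Measure S} {Q : Model S A ν}
    {𝓜 : Set (Model S A ν)} (hQ : Q ∈ 𝓜)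
    {d : Dataset S A K H} {ε L T : ℝ} (hε : 0 < ε) (hL : Real.log 2 ≤ L)
    (hTL : Real.log T = 1 + L)
    (hnet : ∀ P ∈ 𝓜, ∃ R : Model S A ν, (∀ x, |P.density x - R.density x| ≤ ε) ∧
      weightProduct R Q ε d < ENNReal.ofReal T) :
    Q ∈ versionSpace 𝓜 (7 * L) d := by
  refine ⟨hQ, ?_⟩
  rw [EReal.sub_le_iff_le_add (.inl (EReal.coe_ne_bot _)) (.inl (EReal.coe_ne_top _))]
  refine iSup₂_le fun P hP => ?_
  obtain ⟨R, hPR, hR⟩ := hnet P hP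
  have hu : ∀ i, 0 < dataDensity R d i + ε := fun i => add_pos_of_nonneg_of_pos
    (R.density_nonneg _) hε
  obtain ⟨hq, hlog⟩ := sum_log_le_of_prod_lt hu hR
  have hP := logLikelihood_le_coe P d hu fun i => by
    have := (abs_le.1 (hPR ((d.pair i).1, (d.pair i).2, d.next i))).2
    simp only [dataDensity]; linarith
  refine hP.trans ?_
  rw [logLikelihood_eq_coe Q d hq, ← EReal.coe_add, EReal.coe_le_coe_iff]
  have h0 : 0 ≤ ∑ i, hellingerReal R Q (d.pair i) :=
    Finset.sum_nonneg fun i _ => hellingerReal_nonneg R Q _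
  -- The likelihood gain is at most `2 + 2 L`, which is below `7 L` since `L > 5 / 8`.
  have := log_two_gt_five_eighths
  change _ ≤ 2 * Real.log T + ∑ i, Real.log (dataDensity Q d i) at hlog
  linarith

theorem sum_hellingerReal_le_of_weightProduct_lt {𝓜 : Set (Model S A ν)} (hQ : Q ∈ 𝓜)
    {d : Dataset S A K H} {ε L T : ℝ} (hε : 0 < ε) (hε1 : K * H * ν.real Set.univ * ε ≤ 1)
    (hL : Real.log 2 ≤ L) (hTL : Real.log T = 1 + L) {P R : Model S A ν}
    (hP : P ∈ versionSpace 𝓜 (7 * L) d) (hPR : ∀ x, |P.density x - R.density x| ≤ ε)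
    (hR : weightProduct R Q ε d < ENNReal.ofReal T) :
    ∑ i, hellingerReal P Q (d.pair i) ≤ 26 * L := by
  have hu : ∀ i, 0 < dataDensity R d i + ε := fun i => add_pos_of_nonneg_of_pos
    (R.density_nonneg _) hε
  obtain ⟨hq, hlog⟩ := sum_log_le_of_prod_lt hu hR
  have hPu := logLikelihood_le_coe P d hu fun i => by
    have := (abs_le.1 (hPR ((d.pair i).1, (d.pair i).2, d.next i))).2
    simp only [dataDensity]; linarith
  have h1 := hP.2.trans hPu
  rw [EReal.sub_le_iff_le_add (.inl (EReal.coe_ne_bot _)) (.inl (EReal.coe_ne_top _))] at h1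
  have h2 := (le_iSup₂ (f := fun P' (_ : P' ∈ 𝓜) => logLikelihood P' d) Q hQ).trans h1
  rw [logLikelihood_eq_coe Q d hq, ← EReal.coe_add, EReal.coe_le_coe_iff] at h2
  have h3 : ∑ i, hellingerReal P Q (d.pair i) ≤
      ∑ i, (2 * hellingerReal R Q (d.pair i) + ε * ν.real Set.univ) :=
    Finset.sum_le_sum fun i _ => hellingerReal_le_of_abs_sub_le P R Q hPR _
  rw [Finset.sum_add_distrib, ← Finset.mul_sum] at h3
  have h4 : ∑ _i : Fin K × Fin H, ε * ν.real Set.univ ≤ 1 := by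
    refine le_trans (le_of_eq ?_) hε1
    simp; ring
  -- The net point has cumulative distance at most `2 + 9 L`; passing to `P` doubles this and adds
  -- `1`, giving `5 + 18 L ≤ 26 L`.
  have := log_two_gt_five_eighths
  change _ + ∑ i, hellingerReal R Q (d.pair i) ≤
    2 * Real.log T + ∑ i, Real.log (dataDensity Q d i) at hlog
  linarith

/-- Maximum likelihood guarantee: up to probability `δ`, the version space contains the ground
truth, and all its members are close to the ground truth along the data. -/
theorem IsOfflineData.exists_good_event (hD : IsOfflineData μ Q s₀ D) (hK : 0 < K) (hH : 0 < H)
    {𝓜 : Set (Model S A ν)} (hQ : Q ∈ 𝓜) {N : ℕ} (hN : modelBracketingNumber K H 𝓜 = N)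
    {δ : ℝ} (hδ : 0 < δ) (hδN : 2 * δ ≤ N) :
    ∃ G : Set Ω, μ Gᶜ ≤ ENNReal.ofReal δ ∧ ∀ ω ∈ G,
      Q ∈ versionSpace 𝓜 (7 * Real.log (N / δ)) (D ω) ∧
      ∀ P ∈ versionSpace 𝓜 (7 * Real.log (N / δ)) (D ω),
        ∑ i, hellingerReal P Q ((D ω).pair i) ≤ 26 * Real.log (N / δ) := by
  obtain ⟨ω₀⟩ := nonempty_of_isProbabilityMeasure μ
  have hν : 0 < ν.real Set.univ := by
    rw [measureReal_def, ENNReal.toReal_pos_iff, Measure.measure_univ_pos]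
    refine ⟨fun h => ?_, measure_lt_top _ _⟩
    have := Q.lintegral_section ((D ω₀).pair (⟨0, hK⟩, ⟨0, hH⟩))
    simp [h] at this
  set ε : ℝ := ((K : ℝ) * H * ν.real Set.univ)⁻¹ with hεdef
  have hKHν : 0 < (K : ℝ) * H * ν.real Set.univ := by positivity
  have hε : 0 < ε := inv_pos.2 hKHν
  have hε1 : K * H * ν.real Set.univ * ε ≤ 1 := (mul_inv_cancel₀ hKHν.ne').le
  obtain ⟨F, hFN, hF⟩ := exists_finset_net ⟨Q, hQ⟩ hN
  have hN0 : (0 : ℝ) < N := by linarith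
  have hNδ : 0 < N / δ := by positivity
  -- With mean at most `e`, Markov's inequality at this threshold leaves `δ / N` per net point.
  set T : ℝ := Real.exp 1 * (N / δ) with hTdef
  have hT : 0 < T := by positivity
  have hTL : Real.log T = 1 + Real.log (N / δ) := by
    rw [hTdef, Real.log_mul (Real.exp_ne_zero _) hNδ.ne', Real.log_exp]
  have hL : Real.log 2 ≤ Real.log (N / δ) :=
    Real.log_le_log two_pos ((le_div_iff₀ hδ).2 hδN)
  refine ⟨{ω | ∀ R ∈ F, weightProduct R Q ε (D ω) < ENNReal.ofReal T}, ?_, fun ω hω => ?_⟩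
  · have hsub : {ω | ∀ R ∈ F, weightProduct R Q ε (D ω) < ENNReal.ofReal T}ᶜ ⊆
        ⋃ R ∈ F, {ω | ENNReal.ofReal T ≤ weightProduct R Q ε (D ω)} := fun ω hω => by
      simpa using hω
    calc _ ≤ ∑ R ∈ F, μ {ω | ENNReal.ofReal T ≤ weightProduct R Q ε (D ω)} :=
          (measure_mono hsub).trans (measure_biUnion_finset_le _ _)
      _ ≤ ∑ _R ∈ F, ENNReal.ofReal (Real.exp 1 / T) :=
          Finset.sum_le_sum fun R _ => hD.measure_le_weightProduct_le R hε.le hε1 hT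
      _ ≤ N * ENNReal.ofReal (Real.exp 1 / T) := by
          rw [Finset.sum_const, nsmul_eq_mul]
          gcongr
      _ = ENNReal.ofReal δ := by
          rw [← ENNReal.ofReal_natCast, ← ENNReal.ofReal_mul hN0.le, hTdef]
          congr 1
          field_simp
  · have hnet : ∀ P ∈ 𝓜, ∃ R : Model S A ν, (∀ x, |P.density x - R.density x| ≤ ε) ∧
        weightProduct R Q ε (D ω) < ENNReal.ofReal T := fun P hP => by
      obtain ⟨R, hR, hPR⟩ := hF P hP
      exact ⟨R, hPR, hω R hR⟩
    refine ⟨mem_versionSpace_of_weightProduct_lt hQ hε hL hTL hnet, fun P hP => ?_⟩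
    obtain ⟨R, hPR, hR⟩ := hnet P hP.1
    exact sum_hellingerReal_le_of_weightProduct_lt hQ hε hε1 hL hTL hP hPR hR

end MLE

/-! ### Coverage transfer and pessimism -/

section Planning

variable {ν : Measure S} [IsFiniteMeasure ν] {K H : ℕ} {Q : Model S A ν} {s₀ : S}
  {𝓜 : Set (Model S A ν)} {d : Dataset S A K H}

theorem sum_lintegral_occupancy_le {P : Model S A ν} (hP : P ∈ 𝓜) (hK : 0 < K) {π : Policy S A}
    {C E : ℝ} (hC : 0 ≤ C) (hcov : concentrability 𝓜 Q s₀ d π ≤ ENNReal.ofReal C)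
    (hE : ∑ i, hellingerReal P Q (d.pair i) ≤ E) :
    ∑ h : Fin H, ∫⁻ x, hellingerSq P Q x ∂(occupancy Q π s₀ h) ≤ ENNReal.ofReal (C * E / K) := by
  have hK0 : (K : ℝ≥0∞) ≠ 0 := by simpa using hK.ne'
  have hfin : ∀ h : Fin H, (∑ k : Fin K, hellingerSq P Q (d.pair (k, h))) / (K : ℝ≥0∞) ≠ ⊤ :=
    fun h => ENNReal.div_ne_top (ENNReal.sum_ne_top.2 fun k _ => hellingerSq_ne_top P Q _) hK0
  have hstep : ∀ h : Fin H, ∫⁻ x, hellingerSq P Q x ∂(occupancy Q π s₀ h) ≤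
      ENNReal.ofReal C * ((∑ k : Fin K, hellingerSq P Q (d.pair (k, h))) / (K : ℝ≥0∞)) :=
    fun h => by
      -- A finite coefficient forces the numerator to vanish wherever the denominator does, so
      -- clearing denominators is safe.
      refine (ENNReal.div_le_iff_le_mul (.inr ENNReal.ofReal_ne_top) (.inl (hfin h))).1
        (le_trans ?_ hcov)
      exact le_iSup_of_le h (le_iSup₂_of_le P hP le_rfl)
  have hsum : ∑ h : Fin H, ∑ k : Fin K, hellingerSq P Q (d.pair (k, h)) =
      ENNReal.ofReal (∑ i, hellingerReal P Q (d.pair i)) := by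
    rw [ENNReal.ofReal_sum_of_nonneg fun i _ => hellingerReal_nonneg P Q _,
      Fintype.sum_prod_type_right]
    exact Finset.sum_congr rfl fun h _ => Finset.sum_congr rfl fun k _ =>
      (ENNReal.ofReal_toReal (hellingerSq_ne_top P Q _)).symm
  calc _ ≤ ∑ h : Fin H, ENNReal.ofReal C *
          ((∑ k : Fin K, hellingerSq P Q (d.pair (k, h))) / (K : ℝ≥0∞)) :=
        Finset.sum_le_sum fun h _ => hstep h
    _ = ENNReal.ofReal C * (ENNReal.ofReal (∑ i, hellingerReal P Q (d.pair i)) / K) := by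
        simp_rw [← hsum, ENNReal.div_eq_inv_mul, ← Finset.mul_sum]
    _ = ENNReal.ofReal (C * ((∑ i, hellingerReal P Q (d.pair i)) / K)) := by
        rw [ENNReal.ofReal_mul hC, ENNReal.ofReal_div_of_pos (by exact_mod_cast hK),
          ENNReal.ofReal_natCast]
    _ ≤ _ := by
        rw [mul_div_assoc]
        gcongr

/-- The true value of `πhat` dominates its pessimistic value, hence that of `πstar`. Only the latter
is compared with a true value by simulation, so coverage and variance of `πhat` never enter. -/
theorem suboptimality_le {r : S × A → ℝ} (hr : Measurable r) (hK : 0 < K) (hH : 0 < H)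
    (hval : ∀ P ∈ 𝓜, ∀ (π : Policy S A) (h : ℕ), h ≤ H → ∀ s : S,
      value r H P π h s ∈ Set.Icc (0 : ℝ) 1) (hQ : Q ∈ 𝓜) {β L c : ℝ} (hL : 0 ≤ L) (hc : 0 ≤ c)
    (hQv : Q ∈ versionSpace 𝓜 β d)
    (hv : ∀ P ∈ versionSpace 𝓜 β d, ∑ i, hellingerReal P Q (d.pair i) ≤ c * L)
    {πhat πstar : Policy S A} (hπ : IsPessimisticPolicy (H := H) r s₀ 𝓜 β d πhat) {C : ℝ}
    (hC : 0 ≤ C) (hcov : concentrability 𝓜 Q s₀ d πstar ≤ ENNReal.ofReal C) :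
    value r H Q πstar 0 s₀ - value r H Q πhat 0 s₀ ≤
      (4 + 148 * c) * secondOrderRate C (returnVariance r H Q πstar s₀) L K := by
  have hne : Nonempty (versionSpace 𝓜 β d) := ⟨⟨Q, hQv⟩⟩
  have hbdd : BddBelow (Set.range fun P : versionSpace 𝓜 β d => value r H P.1 πhat 0 s₀) :=
    ⟨0, by rintro _ ⟨P, rfl⟩; exact (hval P.1 P.2.1 πhat 0 (Nat.zero_le _) s₀).1⟩
  have h1 : (⨅ P : versionSpace 𝓜 β d, value r H P.1 πhat 0 s₀) ≤ value r H Q πhat 0 s₀ :=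
    ciInf_le hbdd ⟨Q, hQv⟩
  have h2 : value r H Q πstar 0 s₀ -
      (4 + 148 * c) * secondOrderRate C (returnVariance r H Q πstar s₀) L K ≤
      ⨅ P : versionSpace 𝓜 β d, value r H P.1 πstar 0 s₀ := by
    refine le_ciInf fun P => ?_
    have hB : 0 ≤ C * L / K := by positivity
    have hΔ := sum_lintegral_occupancy_le P.2.1 hK hC hcov (hv P.1 P.2)
    have e : C * (c * L) / K = c * (C * L / K) := by ring
    rw [e] at hΔ
    have := value_sub_value_le P.1 Q πstar hr hH (hval P.1 P.2.1) (hval Q hQ) s₀ hB hc hΔ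
    have e' : C * L / K * returnVariance r H Q πstar s₀ =
      C * returnVariance r H Q πstar s₀ * L / K := by ring
    rw [e'] at this
    rw [secondOrderRate]
    linarith
  have h3 := hπ πstar
  linarith

end Planning

end

end OfflineRL

theorem mainTheorem6 :
    ∃ c : ℝ, 0 < c ∧
      ∀ (S A Ω : Type*) [MeasurableSpace S] [MeasurableSpace A] [MeasurableSpace Ω]
        (ν : Measure S) [IsFiniteMeasure ν] (μ : Measure Ω) [IsProbabilityMeasure μ]
        (K H : ℕ) (_ : 0 < K) (_ : 0 < H)
        (r : S × A → ℝ) (_ : Measurable r) (s₀ : S)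
        (𝓜 : Set (OfflineRL.Model S A ν)) (Pstar : OfflineRL.Model S A ν) (_ : Pstar ∈ 𝓜)
        (_ : ∀ P ∈ 𝓜, ∀ (π : OfflineRL.Policy S A) (h : ℕ), h ≤ H → ∀ s : S,
          OfflineRL.value r H P π h s ∈ Set.Icc (0 : ℝ) 1)
        (D : Ω → OfflineRL.Dataset S A K H) (_ : OfflineRL.IsOfflineData μ Pstar s₀ D)
        (N : ℕ) (_ : OfflineRL.modelBracketingNumber K H 𝓜 = N)
        (δ : ℝ) (_ : 0 < δ) (_ : δ < 1) (_ : 2 * δ ≤ N),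
        (μ {ω | ¬ ∀ πhat : OfflineRL.Policy S A,
            OfflineRL.IsPessimisticPolicy r s₀ 𝓜 (7 * Real.log (N / δ)) (D ω) πhat →
            ∀ πstar : OfflineRL.Policy S A,
              OfflineRL.concentrability 𝓜 Pstar s₀ (D ω) πstar ≠ ⊤ →
              OfflineRL.value r H Pstar πstar 0 s₀ - OfflineRL.value r H Pstar πhat 0 s₀ ≤
                c * OfflineRL.secondOrderRate
                  (OfflineRL.concentrability 𝓜 Pstar s₀ (D ω) πstar).toReal
                  (OfflineRL.returnVariance r H Pstar πstar s₀) (Real.log (N / δ)) K}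
          ≤ ENNReal.ofReal δ) ∧
        ∀ (πstar : OfflineRL.Policy S A) (C δ' : ℝ), 0 ≤ C → 0 ≤ δ' →
          μ {ω | ¬ OfflineRL.concentrability 𝓜 Pstar s₀ (D ω) πstar ≤ ENNReal.ofReal C}
            ≤ ENNReal.ofReal δ' →
          μ {ω | ¬ ∀ πhat : OfflineRL.Policy S A,
              OfflineRL.IsPessimisticPolicy r s₀ 𝓜 (7 * Real.log (N / δ)) (D ω) πhat →
              OfflineRL.value r H Pstar πstar 0 s₀ - OfflineRL.value r H Pstar πhat 0 s₀ ≤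
                c * OfflineRL.secondOrderRate C
                  (OfflineRL.returnVariance r H Pstar πstar s₀) (Real.log (N / δ)) K}
            ≤ ENNReal.ofReal (δ + δ') := by
  refine ⟨4 + 148 * 26, by norm_num, ?_⟩
  intro S A Ω _ _ _ ν _ μ _ K H hK hH r hr s₀ 𝓜 Pstar hP hval D hD N hN δ hδ _ hδN
  obtain ⟨G, hGδ, hG⟩ := hD.exists_good_event hK hH hP hN hδ hδN
  have hL : 0 ≤ Real.log (N / δ) :=
    Real.log_nonneg ((one_le_div hδ).2 (by linarith))
  -- The good event does not depend on the comparator or on `C`, so `C` may be the random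
  -- coefficient itself in the first claim and a constant in the second.
  have key : ∀ ω ∈ G, ∀ πhat : OfflineRL.Policy S A,
      OfflineRL.IsPessimisticPolicy r s₀ 𝓜 (7 * Real.log (N / δ)) (D ω) πhat →
      ∀ (πstar : OfflineRL.Policy S A) (C : ℝ), 0 ≤ C →
      OfflineRL.concentrability 𝓜 Pstar s₀ (D ω) πstar ≤ ENNReal.ofReal C →
      OfflineRL.value r H Pstar πstar 0 s₀ - OfflineRL.value r H Pstar πhat 0 s₀ ≤
        (4 + 148 * 26) * OfflineRL.secondOrderRate C
          (OfflineRL.returnVariance r H Pstar πstar s₀) (Real.log (N / δ)) K :=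
    fun ω hω πhat hπ πstar C hC hcov => OfflineRL.suboptimality_le hr hK hH hval hP hL
      (by norm_num) (hG ω hω).1 (hG ω hω).2 hπ hC hcov
  refine ⟨le_trans (measure_mono ?_) hGδ, ?_⟩
  · intro ω hω hωG
    refine hω fun πhat hπ πstar hfin => ?_
    exact key ω hωG πhat hπ πstar _ ENNReal.toReal_nonneg (ENNReal.ofReal_toReal hfin).ge
  · intro πstar C δ' hC hδ' hcov
    rw [ENNReal.ofReal_add hδ.le hδ']
    refine (measure_mono (t := Gᶜ ∪
      {ω | ¬ OfflineRL.concentrability 𝓜 Pstar s₀ (D ω) πstar ≤ ENNReal.ofReal C})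
      fun ω hω => ?_).trans ((measure_union_le _ _).trans (add_le_add hGδ hcov))
    by_contra hcon
    simp only [Set.mem_union, Set.mem_compl_iff, Set.mem_ofPred_eq, not_or, not_not] at hcon
    exact hω fun πhat hπ => key ω hcon.1 πhat hπ πstar C hC hcon.2
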